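/- A (nonnegative-real-weighted Boolean) constraint of arity $k$ is a function $h:\{0,1\}^k\to\mathbb{R}^{\ge 0}$; its underlying relation is $R_h=\{x\mid h(x)\neq 0\}$. Write a binary constraint as $(h(00),h(01),h(10),h(11))$, so that $OR=(0,1,1,1)$, $NAND=(1,1,1,0)$ and $Implies=(1,1,0,1)$; put $\Delta_0=(1,0)$ and $\Delta_1=(0,1)$. The constraint $h$ has affine support if $R_h$ is the solution set of a system of linear equations over $GF(2)$, and it has imp support if $R_h$ is the conjunction of a positive number of relations of the forms $\Delta_0(x_i)$, $\Delta_1(x_i)$ and $Implies(x_i,x_j)$. Let $\mathcal{NZ}$ be the set of constraints that never take the value $0$, and $\mathcal{U}$ the set of all unary constraints. For a set $\mathcal{G}$ of constraints, an instance of $\mathrm{MAX\text{-}PROD\text{-}CSP}(\mathcal{G})$ is a number $n$ of Boolean variables $x_1,\dots,x_n$ together with a finite set $H$ of elements $\langle h,(x_{i_1},\dots,x_{i_k})\rangle$ with $h\in\mathcal{G}$ of arity $k$ and $i_1,\dots,i_k\in[n]$; its solutions are the truth assignments $\sigma$ to $x_1,\dots,x_n$, and the measure to be maximized is $m(H,\sigma)=\prod_{\langle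 h,(x_{i_1},\dots,x_{i_k})\rangle\in H}h(\sigma(x_{i_1}),\dots,\sigma(x_{i_k}))$. Write $\mathrm{MAX\text{-}PROD\text{-}CSP}^*(g,\mathcal{F})$ for $\mathrm{MAX\text{-}PROD\text{-}CSP}(\{g\}\cup\mathcal{F}\cup\mathcal{U})$. A solution $y$ of an instance $x$ with optimum value $m^*(x)$ is $\alpha$-approximate if $1/\alpha\le m(x,y)/m^*(x)\le\alpha$ in the case $m^*(x)\neq0$, and $m(x,y)=0$ in the case $m^*(x)=0$. A randomized approximation scheme takes an instance $x$ and $\varepsilon\in(0,1)$ and outputs a $2^{\varepsilon}$-approximate solution of $x$ with probability at least $3/4$. An APT-reduction from a maximization problem $P$ to a maximization problem $Q$ is a randomized oracle algorithm $N$ with inputs $(x,\varepsilon)$, $x$ an instance of $P$ and $\varepsilon\in(0,1)$, such that, for every randomized approximation scheme $M$ for $Q$ (not necessarily time-bounded) used as oracle, (i) $N$ is a randomized approximation scheme for $P$; (ii) every oracle call is a pair $(w,\delta)$ of an instance $w$ of $Q$ and $\delta\in(0,1)$ with $1/\delta\le p(|x|,1/\varepsilon)$, where $p$ is a polynomial,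 and the answer is an outcome of $M$ on $(w,\delta)$; and (iii) the running time of $N$ is at most $q(|x|,1/\varepsilon)$, where $q$ is a polynomial; here $p$ and $q$ do not depend on $M$, $x$ or $\varepsilon$. Algorithms are real-number (Blum–Shub–Smale) machines with coin flips and unit-cost exact arithmetic, and an instance is given as a string of reals consisting of $n$ in unary and, for each element of $H$, the arity, the table of values and the variable indices; its size $|x|$ is the length of that string. **Proposition.** Let $\mathcal{F}$ be any set of constraints and let $f\notin\mathcal{NZ}$ be any constraint. If $f$ has neither affine support nor imp support, then there exists a constraint $g\in\{OR,NAND\}$ such that $\mathrm{MAX\text{-}PROD\text{-}CSP}^*(g,\mathcal{F})$ is APT-reducible to $\mathrm{MAX\text{-}PROD\text{-}CSP}^*(f,\mathcal{F})$. -/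

import Mathlib

open scoped NNReal ENNReal

noncomputable section

namespace MaxProd

/-! ### Constraints and relations -/

/-- A nonnegative-real-weighted Boolean constraint of some arity `k`,
that is, a function `{0,1}^k → ℝ≥0` (`false` is `0`, `true` is `1`). -/
structure Constraint where
  arity : ℕ
  val : (Fin arity → Bool) → ℝ≥0

/-- `OR = (0,1,1,1)`. -/
def OR : Constraint := ⟨2, fun x => if x 0 = false ∧ x 1 = false then 0 else 1⟩

/-- `NAND = (1,1,1,0)`. -/
def NAND : Constraint := ⟨2, fun x => if x 0 = true ∧ x 1 = true then 0 else 1⟩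

/-- The set of all unary constraints. -/
def U : Set Constraint := {f | f.arity = 1}

/-- The set of all constraints that never take the value zero. -/
def NZ : Set Constraint := {f | ∀ x, f.val x ≠ 0}

/-- The underlying relation `R_f = {x | f x ≠ 0}`. -/
def Constraint.support (f : Constraint) : Set (Fin f.arity → Bool) := {x | f.val x ≠ 0}

/-- A Boolean value as an element of `GF(2)`. -/
def toF2 (b : Bool) : ZMod 2 := if b then 1 else 0

/-- A relation is affine if it is the solution set of a (finite) system of linear equations
over `GF(2)`. -/
def IsAffine {k : ℕ} (R : Set (Fin k → Bool)) : Prop :=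
  ∃ (m : ℕ) (A : Matrix (Fin m) (Fin k) (ZMod 2)) (b : Fin m → ZMod 2),
    R = {x | A.mulVec (fun i => toF2 (x i)) = b}

def Constraint.HasAffineSupport (f : Constraint) : Prop := IsAffine f.support

/-- The relations `Δ₀(x_i)`, `Δ₁(x_i)` and `Implies(x_i, x_j)` on `k` variables. -/
inductive ImpAtom (k : ℕ) where
  | delta0 (i : Fin k)
  | delta1 (i : Fin k)
  | implies (i j : Fin k)

def ImpAtom.Holds {k : ℕ} (x : Fin k → Bool) : ImpAtom k → Prop
  | .delta0 i => x i = false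
  | .delta1 i => x i = true
  | .implies i j => x i = true → x j = true

/-- The underlying relation is a conjunction of a positive number of relations
`Δ₀(x)`, `Δ₁(x)`, `Implies(x,y)`. -/
def Constraint.HasImpSupport (f : Constraint) : Prop :=
  ∃ L : List (ImpAtom f.arity), L ≠ [] ∧ f.support = {x | ∀ a ∈ L, a.Holds x}

/-! ### Maximization problems -/

/-- A maximization problem. Since the data of the problems considered here are real numbers,
an instance is presented to an algorithm as a finite string of reals, one real per cell, and its
size is the length of that string. Solutions are finite bit strings. -/
structure MaxProblem where
  Inst : Type
  enc : Inst → List ℝ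
  enc_injective : Function.Injective enc
  Sol : Inst → Set (List Bool)
  measure : Inst → List Bool → ℝ≥0

namespace MaxProblem

variable (P : MaxProblem)

def size (x : P.Inst) : ℕ := (P.enc x).length

def IsOptimal (x : P.Inst) (z : List Bool) : Prop :=
  z ∈ P.Sol x ∧ ∀ y ∈ P.Sol x, P.measure x y ≤ P.measure x z

/-- `y` is an `α`-approximate solution for the instance `x`: it is a solution and
`1/α ≤ m(x,y)/m*(x) ≤ α`, except that `m(x,y) = 0` is demanded if `m*(x) = 0`. -/
def IsApproxSol (x : P.Inst) (α : ℝ) (y : List Bool) : Prop :=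
  y ∈ P.Sol x ∧ ∃ z, P.IsOptimal x z ∧
    (P.measure x z = 0 → P.measure x y = 0) ∧
    (P.measure x z ≠ 0 →
      1 / α ≤ (P.measure x y : ℝ) / P.measure x z ∧
      (P.measure x y : ℝ) / P.measure x z ≤ α)

/-- The random bit string `D` is a `2^ε`-approximate solution for `x`
with probability at least `3/4`. -/
def ApproxLikely (x : P.Inst) (ε : ℝ) (D : PMF (List Bool)) : Prop :=
  (3 / 4 : ℝ≥0∞) ≤ D.toOuterMeasure {y | P.IsApproxSol x (2 ^ ε) y}

/-- `M`, a (not necessarily time-bounded) random map on input strings, is a randomized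
approximation scheme for `P`: on the input `(x, ε)`, presented as the string `ε :: enc x`, it
outputs a `2^ε`-approximate solution with probability at least `3/4`. -/
def IsApproxScheme (M : List ℝ → PMF (List Bool)) : Prop :=
  ∀ (x : P.Inst) (ε : ℝ), 0 < ε → ε < 1 → P.ApproxLikely x ε (M (ε :: P.enc x))

end MaxProblem

/-! ### Randomized oracle machines over the reals

The model is that of Blum, Shub and Smale (a multi-stack real machine with unit-cost exact
arithmetic and comparison, and finitely many real constants in its program), with coin flips and
an oracle. Programs are finite syntax trees, so a program uses only finitely many stacks. -/

inductive ArithOp where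
  | add | sub | mul | div

def ArithOp.eval : ArithOp → ℝ → ℝ → ℝ
  | .add, a, b => a + b
  | .sub, a, b => a - b
  | .mul, a, b => a * b
  | .div, a, b => a / b

/-- Tests: stack `i` is nonempty; stack `i` is nonempty and its top is positive. -/
inductive Test where
  | nonempty (i : ℕ)
  | pos (i : ℕ)

/-- The contents of the stacks; the head of the list is the top of the stack. -/
abbrev Store := ℕ → List ℝ

def Test.Holds (s : Store) : Test → Prop
  | .nonempty i => s i ≠ []
  | .pos i => ∃ a l, s i = a :: l ∧ 0 < a

inductive Prog where
  /-- do nothing -/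
  | skip
  /-- push the constant `c` on stack `i` -/
  | push (i : ℕ) (c : ℝ)
  /-- remove the top of stack `i` -/
  | pop (i : ℕ)
  /-- push the top of stack `i` on stack `j` -/
  | copy (i j : ℕ)
  /-- replace the two top cells `b, a` of stack `i` (`b` on top) by `a op b` -/
  | arith (op : ArithOp) (i : ℕ)
  /-- push a fair random bit on stack `i` -/
  | flip (i : ℕ)
  /-- call the oracle -/
  | query
  | seq (p q : Prog)
  | cond (t : Test) (p q : Prog)
  | loop (t : Test) (p : Prog)

/-- A configuration: the list of programs still to be run, and the store. The machine has halted
when that list is empty. -/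
abbrev Cfg := List Prog × Store

def bit (b : Bool) : ℝ := if b then 1 else 0

def copyTop (i j : ℕ) (s : Store) : Store :=
  match s i with
  | [] => s
  | a :: _ => Function.update s j (a :: s j)

def arithTop (op : ArithOp) (i : ℕ) (s : Store) : Store :=
  match s i with
  | b :: a :: l => Function.update s i (op.eval a b :: l)
  | _ => s

open Classical in
/-- One step with the oracle `M`. An oracle call draws a fresh answer of `M` on the contents of
stack `1`, erases stack `1` and writes the answer on stack `2` in place of its old contents. -/
def step (M : List ℝ → PMF (List Bool)) : Cfg → PMF Cfg
  | ([], s) => PMF.pure ([], s)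
  | (.skip :: K, s) => PMF.pure (K, s)
  | (.push i c :: K, s) => PMF.pure (K, Function.update s i (c :: s i))
  | (.pop i :: K, s) => PMF.pure (K, Function.update s i (s i).tail)
  | (.copy i j :: K, s) => PMF.pure (K, copyTop i j s)
  | (.arith op i :: K, s) => PMF.pure (K, arithTop op i s)
  | (.flip i :: K, s) =>
      (PMF.uniformOfFintype Bool).map fun b => (K, Function.update s i (bit b :: s i))
  | (.query :: K, s) =>
      (M (s 1)).map fun y => (K, Function.update (Function.update s 1 []) 2 (y.map bit))
  | (.seq p q :: K, s) => PMF.pure (p :: q :: K, s)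
  | (.cond t p q :: K, s) => PMF.pure (if t.Holds s then p :: K else q :: K, s)
  | (.loop t p :: K, s) => PMF.pure (if t.Holds s then p :: .loop t p :: K else K, s)

/-- The distribution of the configuration after `t` steps. -/
def run (M : List ℝ → PMF (List Bool)) : ℕ → Cfg → PMF Cfg
  | 0, c => PMF.pure c
  | t + 1, c => (step M c).bind (run M t)

/-- Initially the input is on stack `0` and all other stacks are empty. -/
def initCfg (N : Prog) (input : List ℝ) : Cfg :=
  ([N], Function.update (fun _ => []) 0 input)

/-- The output is the bit string on stack `3` (positive cells are read as `1`). -/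
def readOutput (c : Cfg) : List Bool := (c.2 3).map fun r => decide (0 < r)

/-- The value at `(|x|, 1/ε)` of a polynomial in two variables. -/
def polyVal (p : MvPolynomial (Fin 2) ℝ) (n : ℕ) (ε : ℝ) : ℝ :=
  MvPolynomial.eval ![(n : ℝ), 1 / ε] p

/-- Polynomial-time randomized approximation-preserving Turing reducibility of `P` to `Q`. -/
def APTReduces (P Q : MaxProblem) : Prop :=
  ∃ (N : Prog) (p q : MvPolynomial (Fin 2) ℝ),
    ∀ M : List ℝ → PMF (List Bool), Q.IsApproxScheme M →
    ∀ (x : P.Inst) (ε : ℝ), 0 < ε → ε < 1 →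
      -- every oracle call is `(w, δ)` with `δ ∈ (0,1)` and `1/δ ≤ p(|x|, 1/ε)`
      (∀ t, ∀ c ∈ (run M t (initCfg N (ε :: P.enc x))).support,
        c.1.head? = some Prog.query →
          ∃ (w : Q.Inst) (δ : ℝ), 0 < δ ∧ δ < 1 ∧ c.2 1 = δ :: Q.enc w ∧
            1 / δ ≤ polyVal p (P.size x) ε) ∧
      -- on every computation path `N` halts within `q(|x|, 1/ε)` steps, and its output is
      -- a `2^ε`-approximate solution with probability at least `3/4`
      ∃ t : ℕ, (t : ℝ) ≤ polyVal q (P.size x) ε ∧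
        (∀ c ∈ (run M t (initCfg N (ε :: P.enc x))).support, c.1 = []) ∧
        P.ApproxLikely x ε ((run M t (initCfg N (ε :: P.enc x))).map readOutput)

/-! ### Product constraint satisfaction problems -/

/-- An element `⟨h, (x_{i_1}, …, x_{i_k})⟩`: a constraint applied to variables among
`x_0, …, x_{n-1}`. -/
structure Application (n : ℕ) where
  con : Constraint
  scope : Fin con.arity → Fin n

/-- An instance of `MAX-PROD-CSP(F)`: a number `n` of variables and a finite set `H` of
applications of constraints of `F`, the set being listed without repetition. -/
structure CSPInst (F : Set Constraint) where
  n : ℕ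
  H : List (Application n)
  nodup : H.Nodup
  mem : ∀ a ∈ H, a.con ∈ F

/-- The values of a function on `{0,1}^k` in the lexicographic order of the arguments. -/
def table : (k : ℕ) → ((Fin k → Bool) → ℝ≥0) → List ℝ
  | 0, h => [(h Fin.elim0 : ℝ)]
  | k + 1, h => table k (fun x => h (Fin.cons false x)) ++ table k (fun x => h (Fin.cons true x))

/-- The arity of the constraint, its table of values, and the indices of the variables. -/
def Application.enc {n : ℕ} (a : Application n) : List ℝ :=
  (a.con.arity : ℝ) ::
    (table a.con.arity a.con.val ++ List.ofFn fun j => ((a.scope j : ℕ) : ℝ))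

/-- The number of variables in unary, and the list of applications. -/
def CSPInst.enc {F : Set Constraint} (x : CSPInst F) : List ℝ :=
  List.replicate x.n 1 ++ 0 :: x.H.flatMap Application.enc

/-- The truth assignment given by a bit string. -/
def assignment (n : ℕ) (y : List Bool) (i : Fin n) : Bool := y.getD i false

/-- The product of the values of all constraints under the assignment `y`. -/
def CSPInst.value {F : Set Constraint} (x : CSPInst F) (y : List Bool) : ℝ≥0 :=
  (x.H.map fun a => a.con.val fun j => assignment x.n y (a.scope j)).prod

theorem table_length (k : ℕ) (h : (Fin k → Bool) → ℝ≥0) : (table k h).length = 2 ^ k := by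
  induction k with
  | zero => simp [table]
  | succ k ih => simp [table, ih, pow_succ]; ring

theorem table_injective (k : ℕ) : Function.Injective (table k) := by
  induction k with
  | zero =>
    intro h h' e
    funext x
    simp only [table, List.cons.injEq, NNReal.coe_inj, and_true] at e
    rw [Subsingleton.elim x Fin.elim0, e]
  | succ k ih =>
    intro h h' e
    simp only [table] at e
    obtain ⟨e0, e1⟩ := List.append_inj e (by simp [table_length])
    funext x
    rw [← Fin.cons_self_tail x]
    cases x 0
    · exact congrFun (ih e0) (Fin.tail x)
    · exact congrFun (ih e1) (Fin.tail x)

theorem Application.enc_append_inj {n : ℕ} (a b : Application n) (l l' : List ℝ)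
    (e : a.enc ++ l = b.enc ++ l') : a = b ∧ l = l' := by
  obtain ⟨⟨k, h⟩, v⟩ := a
  obtain ⟨⟨k', h'⟩, v'⟩ := b
  simp only [Application.enc, List.cons_append, List.cons.injEq, Nat.cast_inj,
    List.append_assoc] at e
  obtain ⟨rfl, e⟩ := e
  obtain ⟨e0, e⟩ := List.append_inj e (by simp [table_length])
  obtain ⟨e1, e2⟩ := List.append_inj e (by simp)
  obtain rfl := table_injective _ e0
  have hv : v = v' := by
    funext j
    have := congrFun (List.ofFn_injective e1) j
    exact Fin.ext (by exact_mod_cast this)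
  subst hv
  exact ⟨rfl, e2⟩

theorem flatMap_enc_injective {n : ℕ} :
    Function.Injective fun H : List (Application n) => H.flatMap Application.enc := by
  intro H
  induction H with
  | nil =>
    intro H' e
    cases H' with
    | nil => rfl
    | cons b H' => simp [Application.enc] at e
  | cons a H ih =>
    intro H' e
    cases H' with
    | nil => simp [Application.enc] at e
    | cons b H' =>
      simp only [List.flatMap_cons] at e
      obtain ⟨rfl, e'⟩ := Application.enc_append_inj _ _ _ _ e
      rw [ih e']

theorem replicate_append_inj (n n' : ℕ) (l l' : List ℝ)
    (e : List.replicate n (1 : ℝ) ++ 0 :: l = List.replicate n' 1 ++ 0 :: l') :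
    n = n' ∧ l = l' := by
  induction n generalizing n' with
  | zero =>
    cases n' with
    | zero => simpa using e
    | succ n' => simp [List.replicate_succ] at e
  | succ n ih =>
    cases n' with
    | zero => simp [List.replicate_succ] at e
    | succ n' =>
      simp only [List.replicate_succ, List.cons_append, List.cons.injEq, true_and] at e
      obtain ⟨h, h'⟩ := ih n' e
      exact ⟨by rw [h], h'⟩

theorem CSPInst.enc_injective (F : Set Constraint) :
    Function.Injective (CSPInst.enc (F := F)) := by
  intro x y e
  obtain ⟨n, H, _, _⟩ := x
  obtain ⟨n', H', _, _⟩ := y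
  obtain ⟨h, e⟩ := replicate_append_inj _ _ _ _ e
  simp only at h
  subst h
  obtain rfl := flatMap_enc_injective e
  rfl

/-- `MAX-PROD-CSP(F)`. -/
def maxProdCSP (F : Set Constraint) : MaxProblem where
  Inst := CSPInst F
  enc := CSPInst.enc
  enc_injective := CSPInst.enc_injective F
  Sol x := {y | y.length = x.n}
  measure x y := if y.length = x.n then x.value y else 0

/-- `MAX-PROD-CSP*(F) = MAX-PROD-CSP(F ∪ U)`: all unary constraints are available for free. -/
def maxProdCSPStar (F : Set Constraint) : MaxProblem := maxProdCSP (F ∪ U)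

end MaxProd

end

/-! Suppose the support `R` of `f` is neither affine nor a conjunction of implications and
constants. A relation of positive arity closed under coordinatewise AND and OR is such a conjunction
(`exists_impAtoms_of_closed`), so some `x, y ∈ R` have `x ∧ y ∉ R` or `x ∨ y ∉ R`. Fixing the
coordinates where `x` and `y` agree and identifying the others according to their pattern gives a
binary function `p` with `p 0 1` and `p 1 0` nonzero and `p 0 0` or `p 1 1` zero.

If exactly one of the two vanishes, `p` has the support of OR or NAND, and unary weights equalise
its nonzero values (`exists_gadget_of_forbid`). If both vanish, `p` is a weighted disequality, which
supplies negated literals. A relation closed under `x + y + z` is affine (`isAffine_of_closed`), so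
`R` has three tuples whose sum lies outside it; substituting literals along these tuples and
projecting yields NAND (`exists_gadget_of_neq`).

Both constructions are instances of `Gadget`. Maximised over its auxiliary variables, a gadget has
the same value `κ * W` at every allowed argument and at most `D` at the forbidden one, where `W` is
a free large weight. If `P` bounds all products of values of the source instance and the inverses of
the nonzero ones, then `κ * W ≥ 2 * D * P²` makes any violation cost more than the factor `2^ε < 2`
granted to the oracle. Hence an approximate solution of the translated instance restricts to one of
the source with the same `ε` (`Gadget.exists_target`), and one oracle call suffices.

An instance is a set of applications, so no emitted application may coincide with another or with a
source application: a merged factor would alter the product. For this reason every application of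
`f` in a gadget involves a fresh variable, and the unary constraints on the arguments are multiplied
by distinct constants of size at least `W`.

It remains to run the translation on the machine. A suitable `W` is computed from the product of
`1/c + c + 1` over the input cells `c`; applications of `forbid b` are recognised from their tables
and replaced by straight-line code, all in time linear in the input. -/

open scoped NNReal ENNReal

noncomputable section

namespace MaxProd

/-! ### Big-step semantics of coin-free and oracle-free computations -/

/-- `Exec p s t s'`: the program `p`, started in the store `s`, stops after exactly `t` steps in the
store `s'`, without flipping coins and without calling the oracle. -/
inductive Exec : Prog → Store → ℕ → Store → Prop
  | skip (s) : Exec .skip s 1 s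
  | push (i c s) : Exec (.push i c) s 1 (Function.update s i (c :: s i))
  | pop (i s) : Exec (.pop i) s 1 (Function.update s i (s i).tail)
  | copy (i j s) : Exec (.copy i j) s 1 (copyTop i j s)
  | arith (op i s) : Exec (.arith op i) s 1 (arithTop op i s)
  | seq {p q s t s₁ t' s₂} : Exec p s t s₁ → Exec q s₁ t' s₂ → Exec (.seq p q) s (t + t' + 1) s₂
  | cond_pos {b p q s t s'} : b.Holds s → Exec p s t s' → Exec (.cond b p q) s (t + 1) s'
  | cond_neg {b p q s t s'} : ¬ b.Holds s → Exec q s t s' → Exec (.cond b p q) s (t + 1) s'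
  | loop_done {b p s} : ¬ b.Holds s → Exec (.loop b p) s 1 s
  | loop_step {b p s t s₁ t' s₂} : b.Holds s → Exec p s t s₁ → Exec (.loop b p) s₁ t' s₂ →
      Exec (.loop b p) s (t + t' + 1) s₂

/-- `Steps c t c'`: the machine goes from `c` to `c'` in `t` steps without flipping coins and without
calling the oracle. -/
inductive Steps : Cfg → ℕ → Cfg → Prop
  | refl (c) : Steps c 0 c
  | head {c c₁ t c₂} : c.1.head? ≠ some Prog.query → (∀ M, step M c = PMF.pure c₁) →
      Steps c₁ t c₂ → Steps c (t + 1) c₂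

theorem Steps.trans {c t c₁ t' c₂} (h : Steps c t c₁) (h' : Steps c₁ t' c₂) :
    Steps c (t + t') c₂ := by
  induction h with
  | refl c => simpa using h'
  | @head c c₁ t c₃ h1 h2 _ ih =>
    rw [show t + 1 + t' = t + t' + 1 by omega]
    exact .head h1 h2 (ih h')

theorem Steps.single {c c₁} (h : c.1.head? ≠ some Prog.query)
    (h' : ∀ M, step M c = PMF.pure c₁) : Steps c 1 c₁ := .head h h' (.refl _)

theorem Exec.steps {p s t s'} (h : Exec p s t s') (K : List Prog) :
    Steps (p :: K, s) t (K, s') := by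
  induction h generalizing K with
  | skip | push | pop | copy | arith => exact .single (by simp) fun M => rfl
  | @seq p q s t s₁ t' s₂ _ _ ih ih' =>
    exact .head (by simp) (fun M => rfl) ((ih (q :: K)).trans (ih' K))
  | @cond_pos b p q s t s' hb _ ih =>
    exact .head (by simp) (fun M => by simp [step, hb]) (ih K)
  | @cond_neg b p q s t s' hb _ ih =>
    exact .head (by simp) (fun M => by simp [step, hb]) (ih K)
  | @loop_done b p s hb => exact .single (by simp) fun M => by simp [step, hb]
  | @loop_step b p s t s₁ t' s₂ hb _ _ ih ih' =>
    exact .head (by simp) (fun M => by simp [step, hb]) ((ih _).trans (ih' K))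

theorem Steps.run_add {c t c'} (h : Steps c t c') (M : List ℝ → PMF (List Bool)) (n : ℕ) :
    run M (t + n) c = run M n c' := by
  induction h with
  | refl c => simp
  | @head c c₁ t c₂ _ h2 _ ih =>
    rw [show t + 1 + n = t + n + 1 by omega, run, h2 M, PMF.pure_bind, ih]

/-- Needed for the condition on oracle calls: deterministic stretches contribute none. -/
theorem Steps.not_query {c t c'} (h : Steps c t c') (M : List ℝ → PMF (List Bool)) (i : ℕ)
    (hi : i < t) (d : Cfg) (hd : d ∈ (run M i c).support) : d.1.head? ≠ some Prog.query := by
  induction h generalizing i with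
  | refl c => omega
  | @head c c₁ t c₂ h1 h2 _ ih =>
    cases i with
    | zero =>
      simp only [run, PMF.support_pure, Set.mem_singleton_iff] at hd
      rw [hd]; exact h1
    | succ i =>
      rw [run, h2 M, PMF.pure_bind] at hd
      exact ih i (by omega) hd

theorem run_halted (M : List ℝ → PMF (List Bool)) (n : ℕ) (s : Store) :
    run M n ([], s) = PMF.pure ([], s) := by
  induction n with
  | zero => rfl
  | succ n ih => rw [run, step, PMF.pure_bind, ih]

/-- `Does p s s' b`: the program `p` takes `s` to `s'` in at most `b` steps. -/
def Does (p : Prog) (s s' : Store) (b : ℕ) : Prop := ∃ t ≤ b, Exec p s t s'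

theorem Does.mono {p s s' b b'} (h : Does p s s' b) (hb : b ≤ b') : Does p s s' b' := by
  obtain ⟨t, ht, h⟩ := h
  exact ⟨t, ht.trans hb, h⟩

theorem Does.seq {p q s s₁ s₂ b b'} (h : Does p s s₁ b) (h' : Does q s₁ s₂ b') :
    Does (.seq p q) s s₂ (b + b' + 1) := by
  obtain ⟨t, ht, h⟩ := h
  obtain ⟨t', ht', h'⟩ := h'
  exact ⟨_, by omega, h.seq h'⟩

theorem Does.cond_pos {c p q s s' b} (hc : c.Holds s) (h : Does p s s' b) :
    Does (.cond c p q) s s' (b + 1) := by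
  obtain ⟨t, ht, h⟩ := h
  exact ⟨_, by omega, .cond_pos hc h⟩

theorem Does.cond_neg {c p q s s' b} (hc : ¬ c.Holds s) (h : Does q s s' b) :
    Does (.cond c p q) s s' (b + 1) := by
  obtain ⟨t, ht, h⟩ := h
  exact ⟨_, by omega, .cond_neg hc h⟩

theorem Does.loop_done {c p s} (hc : ¬ c.Holds s) : Does (.loop c p) s s 1 :=
  ⟨1, le_rfl, .loop_done hc⟩

theorem Does.loop_step {c p s s₁ s₂ b b'} (hc : c.Holds s) (h : Does p s s₁ b)
    (h' : Does (.loop c p) s₁ s₂ b') : Does (.loop c p) s s₂ (b + b' + 1) := by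
  obtain ⟨t, ht, h⟩ := h
  obtain ⟨t', ht', h'⟩ := h'
  exact ⟨_, by omega, .loop_step hc h h'⟩

/-- A reduction with a single oracle call, given by a preprocessing program `A` that writes the
oracle query and a postprocessing program `B`. -/
theorem aptReduces_of_single_query (P Q : MaxProblem) (A B : Prog)
    (p q : MvPolynomial (Fin 2) ℝ)
    (h : ∀ (x : P.Inst) (ε : ℝ), 0 < ε → ε < 1 → ∃ (w : Q.Inst) (δ : ℝ) (s : Store) (b₁ b₂ : ℕ)
      (out : List Bool → Store), 0 < δ ∧ δ < 1 ∧ 1 / δ ≤ polyVal p (P.size x) ε ∧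
      s 1 = δ :: Q.enc w ∧
      Does A (Function.update (fun _ => []) 0 (ε :: P.enc x)) s b₁ ∧
      (∀ y, Does B (Function.update (Function.update s 1 []) 2 (y.map bit)) (out y) b₂) ∧
      ((b₁ + b₂ + 3 : ℕ) : ℝ) ≤ polyVal q (P.size x) ε ∧
      ∀ y, Q.IsApproxSol w (2 ^ δ) y →
        P.IsApproxSol x (2 ^ ε) ((out y 3).map fun r => decide (0 < r))) :
    APTReduces P Q := by
  refine ⟨.seq A (.seq .query B), p, q, fun M hM x ε h0 h1 => ?_⟩
  obtain ⟨w, δ, s, b₁, b₂, out, hδ0, hδ1, hp, hs, hA, hB, hq, happ⟩ := h x ε h0 h1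
  obtain ⟨t₁, ht₁, hA⟩ := hA
  have hpre : Steps (initCfg (.seq A (.seq .query B)) (ε :: P.enc x)) (1 + t₁ + 1)
      ([.query, B], s) :=
    ((Steps.single (by simp [initCfg]) (fun M => rfl)).trans (hA.steps _)).trans
      (Steps.single (by simp) fun M => rfl)
  set T := 1 + t₁ + 1 with hT
  -- `T` is the only time at which the query is about to be executed. From `T + 1` on, all
  -- randomness is in the answer `y`.
  have hpost : ∀ n, run M (T + 1 + n) (initCfg (.seq A (.seq .query B)) (ε :: P.enc x)) =
      (M (s 1)).bind fun y =>
        run M n ([B], Function.update (Function.update s 1 []) 2 (y.map bit)) := by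
    intro n
    rw [show T + 1 + n = T + (n + 1) by omega, hpre.run_add M, run, step, PMF.bind_map]
    rfl
  refine ⟨fun t c hc hq => ?_, T + 1 + b₂, ?_, ?_, ?_⟩
  · rcases lt_trichotomy t T with ht | rfl | ht
    · exact absurd hq (hpre.not_query M t ht c hc)
    · have := hpre.run_add M 0
      rw [Nat.add_zero] at this
      rw [this] at hc
      simp only [run, PMF.support_pure, Set.mem_singleton_iff] at hc
      subst hc
      exact ⟨w, δ, hδ0, hδ1, hs, hp⟩
    · obtain ⟨n, rfl⟩ : ∃ n, t = T + 1 + n := ⟨t - (T + 1), by omega⟩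
      rw [hpost, PMF.mem_support_bind_iff] at hc
      obtain ⟨y, -, hc⟩ := hc
      obtain ⟨t₂, -, hy⟩ := hB y
      rcases lt_or_ge n t₂ with hn | hn
      · exact absurd hq ((hy.steps []).not_query M n hn c hc)
      · obtain ⟨k, rfl⟩ := Nat.exists_eq_add_of_le hn
        rw [(hy.steps []).run_add M, run_halted] at hc
        simp only [PMF.support_pure, Set.mem_singleton_iff] at hc
        subst hc
        simp at hq
  · refine le_trans ?_ hq
    exact_mod_cast (by omega : T + 1 + b₂ ≤ b₁ + b₂ + 3)
  all_goals
    -- The postprocessing time may depend on `y`, but is at most `b₂`. A halted configuration is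
    -- stationary, so all paths agree on the common time bound.
    have hrun : run M (T + 1 + b₂) (initCfg (.seq A (.seq .query B)) (ε :: P.enc x)) =
        (M (s 1)).map fun y => ([], out y) := by
      rw [hpost, PMF.map]
      congr 1
      funext y
      obtain ⟨t₂, ht₂, hy⟩ := hB y
      obtain ⟨k, rfl⟩ := Nat.exists_eq_add_of_le ht₂
      rw [(hy.steps []).run_add M, run_halted]
      rfl
    rw [hrun]
  · intro c hc
    rw [PMF.support_map] at hc
    obtain ⟨y, -, rfl⟩ := hc
    rfl
  · have := hM w δ hδ0 hδ1
    unfold MaxProblem.ApproxLikely at this ⊢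
    rw [PMF.map_comp, PMF.toOuterMeasure_map_apply, hs]
    exact this.trans (MeasureTheory.measure_mono fun y hy => happ y hy)

/-! ### Stores with finitely many stacks -/

/-- The store whose stacks are listed in `L`. -/
def st (L : List (List ℝ)) : Store := fun i => L.getD i []

theorem update_st (L : List (List ℝ)) (i : ℕ) (l : List ℝ) (h : i < L.length) :
    Function.update (st L) i l = st (L.set i l) := by
  funext j
  by_cases hj : j = i
  · subst hj; simp [st, h]
  · rw [Function.update_of_ne hj]
    simp [st, List.getElem?_set_ne (Ne.symm hj)]

/-- Effect on the list of stacks of a single command without control flow. -/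
def exL : Prog → List (List ℝ) → List (List ℝ)
  | .push i c, L => L.set i (c :: L.getD i [])
  | .pop i, L => L.set i (L.getD i []).tail
  | .copy i j, L => match L.getD i [] with
    | [] => L
    | a :: _ => L.set j (a :: L.getD j [])
  | .arith op i, L => match L.getD i [] with
    | b :: a :: l => L.set i (op.eval a b :: l)
    | _ => L
  | _, L => L

/-- A single command without control flow that only uses the stacks `0, …, n - 1`. -/
def simple (n : ℕ) : Prog → Bool
  | .skip => true
  | .push i _ => i < n
  | .pop i => i < n
  -- Only the stack written to must be listed; reading an unlisted one gives the empty stack and no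
  -- effect.
  | .copy _ j => j < n
  | .arith _ i => i < n
  | _ => false

theorem length_exL (p : Prog) (L : List (List ℝ)) : (exL p L).length = L.length := by
  cases p <;> simp only [exL, List.length_set]
  all_goals split <;> simp

theorem exec_simple (p : Prog) (L : List (List ℝ)) (h : simple L.length p = true) :
    Exec p (st L) 1 (st (exL p L)) := by
  cases p with
  | skip => exact .skip _
  | push i c =>
    rw [exL, ← update_st _ _ _ (by simpa [simple] using h)]
    exact .push i c _
  | pop i =>
    rw [exL, ← update_st _ _ _ (by simpa [simple] using h)]
    exact .pop i _
  | copy i j =>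
    have e : st (exL (.copy i j) L) = copyTop i j (st L) := by
      have hs : st L i = L.getD i [] := rfl
      simp only [exL, copyTop, hs]
      cases L.getD i [] with
      | nil => rfl
      | cons a l =>
        dsimp only
        rw [update_st _ _ _ (by simpa [simple] using h)]
        rfl
    rw [e]
    exact .copy i j _
  | arith op i =>
    have e : st (exL (.arith op i) L) = arithTop op i (st L) := by
      have hs : st L i = L.getD i [] := rfl
      simp only [exL, arithTop, hs]
      rcases L.getD i [] with _ | ⟨a, _ | ⟨b, l⟩⟩
      · rfl
      · rfl
      · dsimp only
        rw [update_st _ _ _ (by simpa [simple] using h)]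
    rw [e]
    exact .arith op i _
  | _ => simp [simple] at h

/-- Sequential composition of a list of programs. -/
def block : List Prog → Prog
  | [] => .skip
  | p :: l => .seq p (block l)

theorem does_block (l : List Prog) (L L' : List (List ℝ))
    (h : l.all (simple L.length) = true) (e : l.foldl (fun L p => exL p L) L = L') :
    Does (block l) (st L) (st L') (2 * l.length + 1) := by
  induction l generalizing L with
  | nil => subst e; exact ⟨1, by simp, .skip _⟩
  | cons p l ih =>
    simp only [List.all_cons, Bool.and_eq_true] at h
    have h1 : Does p (st L) (st (exL p L)) 1 := ⟨1, le_rfl, exec_simple p L h.1⟩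
    refine (h1.seq (ih (exL p L) (by rw [length_exL]; exact h.2) e)).mono ?_
    simp only [List.length_cons]; omega

/-! ### Gadgets -/

/-- The binary constraint that forbids exactly the argument `(b, b)`. -/
def forbid (b : Bool) : Constraint := ⟨2, fun x => if x 0 = b ∧ x 1 = b then 0 else 1⟩

theorem forbid_false : forbid false = OR := rfl

theorem forbid_true : forbid true = NAND := rfl

/-- The unary constraint `(c, d)`. -/
def unary (c d : ℝ≥0) : Constraint := ⟨1, fun x => if x 0 then d else c⟩

/-- The weight of an assignment `τ` of the local variables of a gadget. Local variables `0` and `1`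
are the arguments; the local variable `l + 2` is auxiliary and carries the unary weight
`c + d * W` with `(c, d) = wt l`. -/
def gadgetVal (f : Constraint) (b : Bool) (m : ℕ) (scopes : List (Fin f.arity → ℕ))
    (wt : ℕ → Bool → ℝ≥0 × ℝ≥0) (nx ny W : ℝ≥0) (τ : ℕ → Bool) : ℝ≥0 :=
  (scopes.map fun s => f.val fun j => τ (s j)).prod *
    ((List.range m).map fun l => (wt l (τ (l + 2))).1 + (wt l (τ (l + 2))).2 * W).prod *
    ((if τ 0 = b then nx else 1) * (if τ 1 = b then ny else 1))

/-- A gadget that simulates `forbid b` by applications of `f` and unary constraints, up to the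
penalty `D / (κ * W)` for the forbidden argument. -/
structure Gadget (f : Constraint) (b : Bool) where
  m : ℕ
  scopes : List (Fin f.arity → ℕ)
  wt : ℕ → Bool → ℝ≥0 × ℝ≥0
  nx : ℝ≥0
  ny : ℝ≥0
  κ : ℝ≥0
  D : ℝ≥0
  -- The two unary constraints on the arguments use the offsets `v` and `v + 1`; these must stay
  -- below the first fresh variable `v + m` of the next copy.
  two_le : 2 ≤ m
  arity_ne : f.arity ≠ 1
  scope_lt : ∀ s ∈ scopes, ∀ j, s j < m + 2
  -- Keeps applications of `f` in a copy apart from source applications, from other copies, and from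
  -- the unary constraints on the arguments.
  fresh : ∀ s ∈ scopes, ∃ j, 2 ≤ s j
  -- The arguments `0` and `1` are identified because `forbid b` may be applied to the same variable
  -- twice.
  nodup : (scopes.map fun s j => if s j = 1 then 0 else s j).Nodup
  κ_pos : 0 < κ
  one_le_D : 1 ≤ D
  val_le : ∀ W, D ≤ W → ∀ τ : ℕ → Bool, ¬ (τ 0 = b ∧ τ 1 = b) →
    gadgetVal f b m scopes wt nx ny W τ ≤ κ * W
  exists_val_eq : ∀ W, D ≤ W → ∀ x y : Bool, ¬ (x = b ∧ y = b) → ∃ τ : ℕ → Bool,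
    τ 0 = x ∧ τ 1 = y ∧ gadgetVal f b m scopes wt nx ny W τ = κ * W
  val_le_of_forbidden : ∀ W, D ≤ W → ∀ τ : ℕ → Bool, τ 0 = b → τ 1 = b →
    gadgetVal f b m scopes wt nx ny W τ ≤ D

/-- An application of a constraint to variables from an unbounded supply. -/
structure RawApp where
  con : Constraint
  scope : Fin con.arity → ℕ

namespace RawApp

def enc (e : RawApp) : List ℝ :=
  (e.con.arity : ℝ) :: (table e.con.arity e.con.val ++ List.ofFn fun j => (e.scope j : ℝ))

def eval (σ : ℕ → Bool) (e : RawApp) : ℝ≥0 := e.con.val fun j => σ (e.scope j)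

def idx (e : RawApp) : List ℕ := List.ofFn e.scope

end RawApp

def prodVal (L : List RawApp) (σ : ℕ → Bool) : ℝ≥0 := (L.map (RawApp.eval σ)).prod

theorem prodVal_append (L L' : List RawApp) (σ : ℕ → Bool) :
    prodVal (L ++ L') σ = prodVal L σ * prodVal L' σ := by simp [prodVal]

theorem prodVal_congr (L : List RawApp) (σ σ' : ℕ → Bool)
    (h : ∀ e ∈ L, ∀ u ∈ e.idx, σ u = σ' u) : prodVal L σ = prodVal L σ' := by
  unfold prodVal
  congr 1
  refine List.map_congr_left fun e he => ?_
  unfold RawApp.eval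
  congr 1
  funext j
  exact h e he _ (by simp [RawApp.idx, List.mem_ofFn])

def Application.raw {n : ℕ} (a : Application n) : RawApp := ⟨a.con, fun j => (a.scope j : ℕ)⟩

theorem Application.enc_raw {n : ℕ} (a : Application n) : a.raw.enc = a.enc := rfl

theorem Application.raw_injective {n : ℕ} : Function.Injective (Application.raw (n := n)) := by
  rintro ⟨c, s⟩ ⟨c', s'⟩ h
  simp only [Application.raw, RawApp.mk.injEq] at h
  obtain ⟨rfl, h⟩ := h
  congr 1
  funext j
  exact Fin.ext (congrFun (eq_of_heq h) j)

theorem Application.raw_idx_lt {n : ℕ} (a : Application n) (u : ℕ) (h : u ∈ a.raw.idx) : u < n := by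
  simp only [Application.raw, RawApp.idx, List.mem_ofFn] at h
  obtain ⟨j, rfl⟩ := h
  exact (a.scope j).2

def bits (y : List Bool) (i : ℕ) : Bool := y.getD i false

/-- A list of raw applications as an instance. -/
theorem exists_inst (𝓕 : Set Constraint) (n : ℕ) (L : List RawApp) (hL : L.Nodup)
    (hlt : ∀ e ∈ L, ∀ u ∈ e.idx, u < n) (hmem : ∀ e ∈ L, e.con ∈ 𝓕) :
    ∃ w : CSPInst 𝓕, w.n = n ∧ w.enc = List.replicate n 1 ++ 0 :: L.flatMap RawApp.enc ∧
      ∀ y, w.value y = prodVal L (bits y) := by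
  have hlt' : ∀ e ∈ L, ∀ j, e.scope j < n :=
    fun e he j => hlt e he _ (by simp [RawApp.idx, List.mem_ofFn])
  let φ : (e : RawApp) → (∀ j, e.scope j < n) → Application n :=
    fun e h => ⟨e.con, fun j => ⟨e.scope j, h j⟩⟩
  have hφ : ∀ e h, (φ e h).raw = e := fun e h => rfl
  refine ⟨⟨n, L.pmap φ hlt', ?_, ?_⟩, rfl, ?_, ?_⟩
  · refine hL.pmap fun e he e' he' h => ?_
    rw [← hφ e he, h, hφ]
  · intro a ha
    obtain ⟨e, he, rfl⟩ := List.mem_pmap.1 ha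
    exact hmem e he
  · unfold CSPInst.enc
    congr 2
    dsimp only
    rw [List.flatMap_def, List.flatMap_def, List.map_pmap]
    congr 1
    exact List.pmap_eq_map (f := RawApp.enc) hlt'
  · intro y
    simp only [CSPInst.value, prodVal, List.map_pmap]
    congr 1
    exact List.pmap_eq_map (f := RawApp.eval (bits y)) hlt'

def Gadget.val {f : Constraint} {b : Bool} (G : Gadget f b) (W : ℝ≥0) (τ : ℕ → Bool) : ℝ≥0 :=
  gadgetVal f b G.m G.scopes G.wt G.nx G.ny W τ

/-- The actual variable for a local variable of a gadget. -/
def loc (i j v : ℕ) : ℕ → ℕ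
  | 0 => i
  | 1 => j
  | l + 2 => v + l

/-- The unary constraint with the value `c * d` at `b` and `d` at `!b`. -/
def scaled (b : Bool) (c d : ℝ≥0) : Constraint :=
  unary (if b then d else c * d) (if b then c * d else d)

theorem scaled_val (b : Bool) (c d : ℝ≥0) (x : Fin (scaled b c d).arity → Bool) :
    (scaled b c d).val x = (if x (0 : Fin 1) = b then c else 1) * d := by
  change (if x (0 : Fin 1) then _ else _) = _
  cases b <;> cases x (0 : Fin 1) <;> simp

namespace Gadget

variable {f : Constraint} {b : Bool} (G : Gadget f b)

/-- The copy of the gadget with arguments `i`, `j` and fresh variables `v, …, v + m - 1`. -/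
def emit (W : ℝ≥0) (v i j : ℕ) : List RawApp :=
  (G.scopes.map fun s => ⟨f, fun l => loc i j v (s l)⟩) ++
  ((List.range G.m).map fun l =>
    ⟨unary ((G.wt l false).1 + (G.wt l false).2 * W) ((G.wt l true).1 + (G.wt l true).2 * W),
      fun _ => v + l⟩) ++
  -- The factors `W + v` and `W + v + 1` serve only to make these constraints distinct from all
  -- others: their value at `!b` exceeds every source value and identifies the copy and the
  -- argument.
  [⟨scaled b G.nx (W + v), fun _ => i⟩, ⟨scaled b G.ny (W + v + 1), fun _ => j⟩]

theorem prodVal_emit (W : ℝ≥0) (v i j : ℕ) (σ : ℕ → Bool) :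
    prodVal (G.emit W v i j) σ =
      G.val W (fun l => σ (loc i j v l)) * ((W + v) * (W + v + 1)) := by
  have h2 : ∀ l, (fun l => σ (loc i j v l)) (l + 2) = σ (v + l) := fun l => rfl
  have h0 : (fun l => σ (loc i j v l)) 0 = σ i := rfl
  have h1 : (fun l => σ (loc i j v l)) 1 = σ j := rfl
  simp only [prodVal, emit, val, gadgetVal, List.map_append, List.map_map, List.prod_append,
    List.map_cons, List.map_nil, List.prod_cons, List.prod_nil, RawApp.eval, h0, h1, h2,
    Function.comp_def, scaled_val]
  have : ∀ l, (unary ((G.wt l false).1 + (G.wt l false).2 * W)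
      ((G.wt l true).1 + (G.wt l true).2 * W)).val (fun _ => σ (v + l)) =
      (G.wt l (σ (v + l))).1 + (G.wt l (σ (v + l))).2 * W := by
    intro l
    change (if σ (v + l) then _ else _) = _
    cases σ (v + l) <;> simp
  simp only [this]
  ring

variable {n : ℕ}

/-- The `c`-th variable of an application. -/
def _root_.MaxProd.Application.arg (a : Application n) (c : ℕ) : ℕ := a.raw.idx.getD c 0

open Classical in
/-- Replaces every application of `forbid b` by a copy of the gadget; `v` is the first fresh
variable. -/
def trans (W : ℝ≥0) : ℕ → List (Application n) → List RawApp
  | _, [] => []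
  | v, a :: H =>
    -- Later applications come first, since the machine builds the query on a stack.
    if a.con = forbid b then trans W (v + G.m) H ++ G.emit W v (a.arg 0) (a.arg 1)
    else trans W v H ++ [a.raw]

open Classical in
/-- The number of variables after the translation. -/
def vEnd : ℕ → List (Application n) → ℕ
  | v, [] => v
  | v, a :: H => if a.con = forbid b then vEnd (v + G.m) H else vEnd v H

open Classical in
/-- The factor by which the translation scales the values. -/
def factor (W : ℝ≥0) : ℕ → List (Application n) → ℝ≥0
  | _, [] => 1
  | v, a :: H =>
    if a.con = forbid b then factor W (v + G.m) H * (G.κ * W * ((W + v) * (W + v + 1)))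
    else factor W v H

end Gadget

/-! ### Source values and the effect of a violation -/

def appVal {n : ℕ} (σ : ℕ → Bool) (a : Application n) : ℝ≥0 := a.raw.eval σ

def srcVal {n : ℕ} (H : List (Application n)) (σ : ℕ → Bool) : ℝ≥0 := (H.map (appVal σ)).prod

theorem appVal_forbid {n : ℕ} {b : Bool} (σ : ℕ → Bool) (a : Application n)
    (h : a.con = forbid b) :
    appVal σ a = if σ (a.arg 0) = b ∧ σ (a.arg 1) = b then 0 else 1 := by
  obtain ⟨c, s⟩ := a
  subst h
  rfl

theorem Application.arg_lt {n : ℕ} {b : Bool} (a : Application n) (h : a.con = forbid b) :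
    a.arg 0 < n ∧ a.arg 1 < n := by
  obtain ⟨c, s⟩ := a
  subst h
  exact ⟨(s (0 : Fin 2)).2, (s (1 : Fin 2)).2⟩

open Classical in
/-- The value of the source instance when a violated application of `forbid b` costs a factor `η`
only. -/
def penVal {n : ℕ} (b : Bool) (η : ℝ≥0) (H : List (Application n)) (σ : ℕ → Bool) : ℝ≥0 :=
  (H.map fun a => if a.con = forbid b then
    (if σ (a.arg 0) = b ∧ σ (a.arg 1) = b then η else 1) else appVal σ a).prod

/-- Without a violation the penalised value is the true one. One violation already contributes `η`;
further ones only decrease the product because `η ≤ 1`, and the other factors are bounded by `u`. -/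
theorem penVal_eq_or_le {n : ℕ} (b : Bool) (η : ℝ≥0) (hη : η ≤ 1) (H : List (Application n))
    (σ : ℕ → Bool) (u : Application n → ℝ≥0) (h1 : ∀ a ∈ H, 1 ≤ u a)
    (hu : ∀ a ∈ H, appVal σ a ≤ u a) :
    (penVal b η H σ = srcVal H σ ∧ srcVal H σ ≤ (H.map u).prod) ∨
      penVal b η H σ ≤ η * (H.map u).prod := by
  induction H with
  | nil => left; simp [penVal, srcVal]
  | cons a H ih =>
    have ih := ih (fun a ha => h1 a (by simp [ha])) (fun a ha => hu a (by simp [ha]))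
    have h1a := h1 a (by simp)
    have hua := hu a (by simp)
    simp only [penVal, srcVal, List.map_cons, List.prod_cons] at ih ⊢
    by_cases hg : a.con = forbid b
    · rw [appVal_forbid σ a hg] at hua ⊢
      simp only [hg, if_true]
      by_cases hv : σ (a.arg 0) = b ∧ σ (a.arg 1) = b
      · simp only [hv, and_self, if_true]
        right
        refine mul_le_mul_right ?_ η
        rcases ih with ⟨e, h⟩ | h
        · rw [e]
          exact h.trans (le_mul_of_one_le_left (by positivity) h1a)
        · exact h.trans ((mul_le_of_le_one_left (by positivity) hη).trans
            (le_mul_of_one_le_left (by positivity) h1a))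
      · simp only [hv, if_false] at hua ⊢
        rcases ih with ⟨e, h⟩ | h
        · left
          exact ⟨by rw [e], by rw [one_mul]; exact h.trans (le_mul_of_one_le_left (by positivity) h1a)⟩
        · right
          rw [one_mul]
          exact h.trans (mul_le_mul_right (le_mul_of_one_le_left (by positivity) h1a) η)
    · simp only [hg, if_false]
      rcases ih with ⟨e, h⟩ | h
      · left
        exact ⟨by rw [e], mul_le_mul' hua h⟩
      · right
        calc _ ≤ u a * (η * (H.map u).prod) := mul_le_mul' hua h
          _ = _ := by ring

/-- The lower bound on a nonzero optimum that separates it from penalised values. -/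
theorem one_le_srcVal_mul {n : ℕ} (H : List (Application n))
    (σ : ℕ → Bool) (u : Application n → ℝ≥0)
    (hu : ∀ a ∈ H, appVal σ a ≠ 0 → 1 ≤ appVal σ a * u a) (h : srcVal H σ ≠ 0) :
    1 ≤ srcVal H σ * (H.map u).prod := by
  induction H with
  | nil => simp [srcVal]
  | cons a H ih =>
    simp only [srcVal, List.map_cons, List.prod_cons] at ih h ⊢
    have h' := mul_ne_zero_iff.1 h
    calc (1 : ℝ≥0) = 1 * 1 := (one_mul 1).symm
      _ ≤ (appVal σ a * u a) * ((H.map (appVal σ)).prod * (H.map u).prod) :=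
        mul_le_mul' (hu a (by simp) h'.1) (ih (fun a ha => hu a (by simp [ha])) h'.2)
      _ = _ := by ring

namespace Gadget

variable {f : Constraint} {b : Bool} (G : Gadget f b) {n : ℕ}

theorem factor_pos (W : ℝ≥0) (hW : G.D ≤ W) (v : ℕ) (H : List (Application n)) :
    0 < G.factor W v H := by
  have hW0 : 0 < W := lt_of_lt_of_le one_pos (G.one_le_D.trans hW)
  have := G.κ_pos
  induction H generalizing v with
  | nil => simp [factor]
  | cons a H ih =>
    simp only [factor]
    split
    · have := ih (v + G.m)
      positivity
    · exact ih v

/-- Fresh variables of different copies are disjoint, so each copy is bounded separately: by `κ * W`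
if its argument is allowed, and by `D ≤ κ * W * η` otherwise. -/
theorem prodVal_trans_le (W η : ℝ≥0) (hW : G.D ≤ W) (hη : G.D ≤ G.κ * W * η) (v : ℕ)
    (H : List (Application n)) (σ : ℕ → Bool) :
    prodVal (G.trans W v H) σ ≤ G.factor W v H * penVal b η H σ := by
  induction H generalizing v with
  | nil => simp [trans, factor, penVal, prodVal]
  | cons a H ih =>
    simp only [penVal, trans, factor, List.map_cons, List.prod_cons]
    by_cases hg : a.con = forbid b
    · simp only [hg, if_true, prodVal_append, prodVal_emit]
      have hG : G.val W (fun l => σ (loc (a.arg 0) (a.arg 1) v l)) ≤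
          G.κ * W * (if σ (a.arg 0) = b ∧ σ (a.arg 1) = b then η else 1) := by
        split_ifs with hv
        · exact (G.val_le_of_forbidden W hW _ hv.1 hv.2).trans hη
        · rw [mul_one]; exact G.val_le W hW _ hv
      calc _ ≤ (G.factor W (v + G.m) H * penVal b η H σ) *
            ((G.κ * W * (if σ (a.arg 0) = b ∧ σ (a.arg 1) = b then η else 1)) *
              ((W + v) * (W + v + 1))) :=
            mul_le_mul' (ih _) (mul_le_mul' hG le_rfl)
        _ = _ := by rw [penVal]; ring
    · simp only [hg, if_false, prodVal_append]
      calc _ ≤ (G.factor W v H * penVal b η H σ) * appVal σ a :=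
            mul_le_mul' (ih _) (le_of_eq (by simp [prodVal, appVal]))
        _ = _ := by rw [penVal]; ring

theorem emit_idx (W : ℝ≥0) (v i j : ℕ) (e : RawApp) (he : e ∈ G.emit W v i j) (u : ℕ)
    (hu : u ∈ e.idx) : u = i ∨ u = j ∨ (v ≤ u ∧ u < v + G.m) := by
  simp only [emit, List.mem_append, List.mem_map, List.mem_range, List.mem_cons,
    List.not_mem_nil, or_false] at he
  rcases he with (⟨s, hs, rfl⟩ | ⟨l, hl, rfl⟩) | rfl | rfl
  · simp only [RawApp.idx, List.mem_ofFn] at hu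
    obtain ⟨c, rfl⟩ := hu
    have := G.scope_lt s hs c
    rcases h : s c with _ | _ | l
    · left; rfl
    · right; left; rfl
    · right; right
      simp only [loc]; omega
  all_goals
    simp only [RawApp.idx, List.mem_ofFn] at hu
    obtain ⟨c, rfl⟩ := hu
    omega

theorem le_vEnd (v : ℕ) (H : List (Application n)) : v ≤ G.vEnd v H := by
  induction H generalizing v with
  | nil => exact le_rfl
  | cons a H ih =>
    simp only [vEnd]
    split
    · exact (Nat.le_add_right _ _).trans (ih _)
    · exact ih _

theorem trans_idx_lt (W : ℝ≥0) (v : ℕ) (hv : n ≤ v) (H : List (Application n)) (e : RawApp)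
    (he : e ∈ G.trans W v H) (u : ℕ) (hu : u ∈ e.idx) : u < G.vEnd v H := by
  induction H generalizing v with
  | nil => simp [trans] at he
  | cons a H ih =>
    simp only [trans, vEnd] at he ⊢
    split at he
    · rename_i hg
      rw [if_pos hg]
      rcases List.mem_append.1 he with he | he
      · exact ih _ (by omega) he
      · have := G.le_vEnd (v + G.m) H
        have := a.arg_lt hg
        rcases G.emit_idx W v _ _ e he u hu with h | h | h <;> omega
    · rename_i hg
      rw [if_neg hg]
      rcases List.mem_append.1 he with he | he
      · exact ih _ hv he
      · simp only [List.mem_singleton] at he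
        subst he
        have := a.raw_idx_lt u hu
        have := G.le_vEnd v H
        omega

/-- A nonzero source value means that no `forbid b` is violated, so every copy can attain `κ * W` by
a choice of its own fresh variables. -/
theorem exists_prodVal_trans_eq (W : ℝ≥0) (hW : G.D ≤ W) (v : ℕ) (hv : n ≤ v)
    (H : List (Application n)) (σ : ℕ → Bool) (h : srcVal H σ ≠ 0) :
    ∃ σ' : ℕ → Bool, (∀ u < v, σ' u = σ u) ∧
      prodVal (G.trans W v H) σ' = G.factor W v H * srcVal H σ := by
  induction H generalizing v σ with
  | nil => exact ⟨σ, fun _ _ => rfl, by simp [trans, factor, srcVal, prodVal]⟩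
  | cons a H ih =>
    simp only [srcVal, List.map_cons, List.prod_cons] at h ⊢
    have h' := mul_ne_zero_iff.1 h
    have congr_src : ∀ σ₁ : ℕ → Bool, (∀ u < v, σ₁ u = σ u) → srcVal H σ₁ = srcVal H σ := by
      intro σ₁ hσ₁
      unfold srcVal
      congr 1
      refine List.map_congr_left fun a _ => ?_
      unfold appVal RawApp.eval
      congr 1
      funext j
      exact hσ₁ _ (lt_of_lt_of_le (a.scope j).2 hv)
    by_cases hg : a.con = forbid b
    · have hlt := a.arg_lt hg
      have hv1 : ¬ (σ (a.arg 0) = b ∧ σ (a.arg 1) = b) := by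
        intro hc
        rw [appVal_forbid σ a hg, if_pos hc] at h'
        exact h'.1 rfl
      obtain ⟨τ, hτ0, hτ1, hτ⟩ := G.exists_val_eq W hW _ _ hv1
      -- Local variable `l + 2` is the actual variable `v + l`. The recursive call starts at `v +
      -- G.m` and therefore leaves these choices intact.
      let σ₁ : ℕ → Bool := fun u => if v ≤ u then τ (u - v + 2) else σ u
      have hσ₁ : ∀ u < v, σ₁ u = σ u := fun u hu => by simp [σ₁, not_le.2 hu]
      obtain ⟨σ', hσ', e⟩ := ih (v + G.m) (by omega) σ₁ (by rw [congr_src σ₁ hσ₁]; exact h'.2)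
      refine ⟨σ', fun u hu => by rw [hσ' u (by omega), hσ₁ u hu], ?_⟩
      simp only [trans, factor, hg, if_true, prodVal_append]
      rw [e, congr_src σ₁ hσ₁, appVal_forbid σ a hg, if_neg hv1,
        prodVal_congr (G.emit W v _ _) σ' σ₁, prodVal_emit]
      · have : (fun l => σ₁ (loc (a.arg 0) (a.arg 1) v l)) = τ := by
          funext l
          rcases l with _ | _ | l
          · simp [loc, hσ₁ _ (lt_of_lt_of_le hlt.1 hv), hτ0]
          · simp [loc, hσ₁ _ (lt_of_lt_of_le hlt.2 hv), hτ1]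
          · simp [loc, σ₁]
        rw [this, val, hτ, srcVal]
        ring
      · intro e he u hu
        apply hσ'
        rcases G.emit_idx W v _ _ e he u hu with h | h | h <;> omega
    · obtain ⟨σ', hσ', e⟩ := ih v hv σ h'.2
      refine ⟨σ', hσ', ?_⟩
      simp only [trans, factor, hg, if_false, prodVal_append]
      have : prodVal [a.raw] σ' = appVal σ a := by
        simp only [prodVal, List.map_cons, List.map_nil, List.prod_cons, List.prod_nil, mul_one,
          appVal, RawApp.eval]
        congr 1
        funext j
        exact hσ' _ (lt_of_lt_of_le (a.scope j).2 hv)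
      rw [e, this, srcVal]
      ring

end Gadget

/-! ### The translated instance -/

namespace Gadget

variable {f : Constraint} {b : Bool} (G : Gadget f b) {n : ℕ}

/-! ### Distinctness of the translated applications -/

/-- The two certificates of novelty: a fresh variable, or a unary value `W + c` with an offset `c`
reserved for this copy. -/
theorem mem_emit_cases (W : ℝ≥0) (v i j : ℕ) (e : RawApp) (he : e ∈ G.emit W v i j) :
    (∃ u ∈ e.idx, v ≤ u) ∨
      ((e.idx = [i] ∨ e.idx = [j]) ∧
        ∃ c : ℕ, v ≤ c ∧ c < v + G.m ∧ e.con.val (fun _ => !b) = W + c) := by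
  have := G.two_le
  simp only [emit, List.mem_append, List.mem_map, List.mem_range, List.mem_cons,
    List.not_mem_nil, or_false] at he
  rcases he with (⟨s, hs, rfl⟩ | ⟨l, hl, rfl⟩) | rfl | rfl
  · left
    obtain ⟨c, hc⟩ := G.fresh s hs
    refine ⟨loc i j v (s c), by simp [RawApp.idx, List.mem_ofFn], ?_⟩
    obtain ⟨l, hl⟩ := Nat.exists_eq_add_of_le' hc
    simp [hl, loc]
  · left
    exact ⟨v + l, List.mem_ofFn.2 ⟨(0 : Fin 1), rfl⟩, by omega⟩
  · right
    refine ⟨.inl rfl, v, le_rfl, by omega, ?_⟩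
    rw [scaled_val]; simp
  · right
    refine ⟨.inr rfl, v + 1, by omega, by omega, ?_⟩
    rw [scaled_val]; simp [add_assoc]

theorem mem_trans_cases (W : ℝ≥0) (v : ℕ) (H : List (Application n)) (e : RawApp)
    (he : e ∈ G.trans W v H) :
    (∃ a ∈ H, a.con ≠ forbid b ∧ e = a.raw) ∨ (∃ u ∈ e.idx, v ≤ u) ∨
      (∃ c : ℕ, v ≤ c ∧ e.con.val (fun _ => !b) = W + c) := by
  induction H generalizing v with
  | nil => simp [trans] at he
  | cons a H ih =>
    simp only [trans] at he
    split at he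
    · rcases List.mem_append.1 he with he | he
      · rcases ih _ he with ⟨a', h, h'⟩ | ⟨u, h, h'⟩ | ⟨c, h, h'⟩
        · exact .inl ⟨a', by simp [h], h'⟩
        · exact .inr (.inl ⟨u, h, by omega⟩)
        · exact .inr (.inr ⟨c, by omega, h'⟩)
      · rcases G.mem_emit_cases W v _ _ e he with h | ⟨-, c, h, -, h'⟩
        · exact .inr (.inl h)
        · exact .inr (.inr ⟨c, h, h'⟩)
    · rename_i hg
      rcases List.mem_append.1 he with he | he
      · rcases ih _ he with ⟨a', h, h'⟩ | h
        · exact .inl ⟨a', by simp [h], h'⟩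
        · exact .inr h
      · exact .inl ⟨a, by simp, hg, by simpa using he⟩

theorem trans_idx (W : ℝ≥0) (v : ℕ) (H : List (Application n)) (e : RawApp)
    (he : e ∈ G.trans W v H) (u : ℕ) (hu : u ∈ e.idx) : u < n ∨ v ≤ u := by
  induction H generalizing v with
  | nil => simp [trans] at he
  | cons a H ih =>
    simp only [trans] at he
    split at he
    · rename_i hg
      have := a.arg_lt hg
      rcases List.mem_append.1 he with he | he
      · have := ih _ he
        omega
      · have := G.emit_idx W v _ _ e he u hu
        omega
    · rcases List.mem_append.1 he with he | he
      · exact ih _ he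
      · simp only [List.mem_singleton] at he
        subst he
        exact .inl (a.raw_idx_lt u hu)

theorem nodup_emit (W : ℝ≥0) (v i j : ℕ) (hi : i < v) (hj : j < v) : (G.emit W v i j).Nodup := by
  unfold emit
  rw [List.nodup_append, List.nodup_append]
  refine ⟨⟨?_, ?_, ?_⟩, ?_, ?_⟩
  · have h := G.nodup
    -- Actual variables determine the local ones, except that both arguments become `0`. This is
    -- exactly the identification in the field `nodup`.
    refine List.Nodup.of_map (fun e : RawApp => e.idx.map fun u =>
      if u < v then 0 else u - v + 2) ?_
    refine List.Nodup.of_map (fun l : List ℕ => fun c : Fin f.arity => l.getD c 0) ?_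
    rw [List.map_map, List.map_map]
    convert h using 2
    funext s c
    have : ((RawApp.idx ⟨f, fun l => loc i j v (s l)⟩).map
        fun u => if u < v then 0 else u - v + 2).getD c 0 =
        if loc i j v (s c) < v then 0 else loc i j v (s c) - v + 2 := by
      simp [RawApp.idx, List.getD]
    simp only [Function.comp]
    rw [this]
    rcases s c with _ | _ | l <;> simp [loc, hi, hj]
  · refine List.Nodup.of_map (fun e : RawApp => e.idx) ?_
    rw [List.map_map]
    refine List.Nodup.map ?_ List.nodup_range
    intro l l' h
    have h : [v + l] = [v + l'] := h
    simpa using h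
  · intro e he e' he' h
    subst h
    simp only [List.mem_map] at he he'
    obtain ⟨s, -, rfl⟩ := he
    obtain ⟨l, -, h⟩ := he'
    exact G.arity_ne (congrArg (fun e : RawApp => e.con.arity) h).symm
  · simp only [List.nodup_cons, List.mem_singleton, List.not_mem_nil, not_false_eq_true,
      List.nodup_nil, and_true]
    intro h
    have := congrArg (fun e : RawApp => e.con.val fun _ => !b) h
    simp only [scaled_val, Bool.not_eq_eq_eq_not, Bool.eq_not_self, if_false,
      one_mul] at this
    simp at this
  · intro e he e' he' h
    subst h
    have h1 : ∃ u ∈ e.idx, v ≤ u := by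
      simp only [List.mem_append, List.mem_map, List.mem_range] at he
      rcases he with ⟨s, hs, rfl⟩ | ⟨l, hl, rfl⟩
      · obtain ⟨c, hc⟩ := G.fresh s hs
        refine ⟨loc i j v (s c), by simp [RawApp.idx, List.mem_ofFn], ?_⟩
        obtain ⟨l, hl⟩ := Nat.exists_eq_add_of_le' hc
        simp [hl, loc]
      · exact ⟨v + l, List.mem_ofFn.2 ⟨(0 : Fin 1), rfl⟩, by omega⟩
    obtain ⟨u, hu, huv⟩ := h1
    simp only [List.mem_cons, List.not_mem_nil, or_false] at he'
    rcases he' with rfl | rfl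
    all_goals
      simp only [RawApp.idx, List.mem_ofFn] at hu
      obtain ⟨c, rfl⟩ := hu
      omega

/-- Source values lie below `W`, so no kept application is a scaled unary one. Different copies use
disjoint ranges of fresh variables and of offsets. -/
theorem nodup_trans (W : ℝ≥0) (v : ℕ) (hv : n ≤ v) (H : List (Application n)) (hH : H.Nodup)
    (hW : ∀ a ∈ H, ∀ x, a.con.val x < W) : (G.trans W v H).Nodup := by
  induction H generalizing v with
  | nil => simp [trans]
  | cons a H ih =>
    have hH' := List.nodup_cons.1 hH
    have hW' : ∀ a ∈ H, ∀ x, a.con.val x < W := fun a ha => hW a (by simp [ha])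
    simp only [trans]
    split
    · rename_i hg
      have hlt := a.arg_lt hg
      refine List.nodup_append.2 ⟨ih _ (by omega) hH'.2 hW',
        G.nodup_emit W v _ _ (by omega) (by omega), ?_⟩
      intro e he e' he' h
      subst h
      rcases G.mem_emit_cases W v _ _ e he' with ⟨u, hu, huv⟩ | ⟨hi, c', hc', hc'', h'⟩
      · have := G.emit_idx W v _ _ e he' u hu
        have := G.trans_idx W (v + G.m) H e he u hu
        omega
      · rcases G.mem_trans_cases W _ H e he with ⟨a', h, -, rfl⟩ | ⟨u, hu, huv⟩ | ⟨c, hc, hcv⟩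
        · have := hW' a' h (fun _ => !b)
          rw [Application.raw] at h'
          rw [h'] at this
          exact absurd this (not_lt.2 le_self_add)
        · have := G.emit_idx W v _ _ e he' u hu
          omega
        · rw [hcv] at h'
          have : c = c' := by simpa using h'
          omega
    · rename_i hg
      refine List.nodup_append.2 ⟨ih _ hv hH'.2 hW', by simp, ?_⟩
      intro e he e' he' h
      subst h
      simp only [List.mem_singleton] at he'
      subst he'
      rcases G.mem_trans_cases W _ H _ he with ⟨a', h, -, h'⟩ | ⟨u, hu, huv⟩ | ⟨c, hc, hcv⟩
      · rw [Application.raw_injective h'] at hH'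
        exact hH'.1 h
      · have := a.raw_idx_lt u hu
        omega
      · have := hW a (by simp) (fun _ => !b)
        rw [Application.raw] at hcv
        rw [hcv] at this
        exact absurd this (not_lt.2 le_self_add)

theorem trans_con_mem (F : Set Constraint) (W : ℝ≥0) (v : ℕ) (H : List (Application n))
    (hH : ∀ a ∈ H, a.con ∈ {forbid b} ∪ F ∪ U) (e : RawApp) (he : e ∈ G.trans W v H) :
    e.con ∈ {f} ∪ F ∪ U := by
  induction H generalizing v with
  | nil => simp [trans] at he
  | cons a H ih =>
    have ih := fun v => ih v fun a ha => hH a (by simp [ha])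
    simp only [trans] at he
    split at he
    · rcases List.mem_append.1 he with he | he
      · exact ih _ he
      · simp only [emit, List.mem_append, List.mem_map, List.mem_range, List.mem_cons,
          List.not_mem_nil, or_false] at he
        rcases he with (⟨s, hs, rfl⟩ | ⟨l, hl, rfl⟩) | rfl | rfl
        · exact .inl (.inl rfl)
        all_goals exact .inr rfl
    · rename_i hg
      rcases List.mem_append.1 he with he | he
      · exact ih _ he
      · simp only [List.mem_singleton] at he
        subst he
        rcases hH a (by simp) with (h | h) | h
        · exact absurd h hg
        · exact .inl (.inr h)
        · exact .inr h

end Gadget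

/-! ### Transfer of approximate solutions -/

theorem exists_isOptimal {F : Set Constraint} (x : CSPInst F) :
    ∃ z, (maxProdCSP F).IsOptimal x z := by
  obtain ⟨z, hz, h⟩ := Set.exists_max_image {y : List Bool | y.length = x.n}
    ((maxProdCSP F).measure x) (List.finite_length_eq Bool x.n) ⟨List.replicate x.n false, by simp⟩
  exact ⟨z, hz, h⟩

theorem srcVal_take {n : ℕ} (H : List (Application n)) (y : List Bool) :
    srcVal H (bits (y.take n)) = srcVal H (bits y) := by
  unfold srcVal
  congr 1
  refine List.map_congr_left fun a _ => ?_
  unfold appVal RawApp.eval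
  congr 1
  funext j
  have : ((a.scope j : ℕ)) < n := (a.scope j).2
  simp [bits, Application.raw, List.getD, this]

theorem le_prod_map_of_one_le {α : Type*} (H : List α) (u : α → ℝ≥0) (h : ∀ a ∈ H, 1 ≤ u a) :
    1 ≤ (H.map u).prod ∧ ∀ a ∈ H, u a ≤ (H.map u).prod := by
  induction H with
  | nil => simp
  | cons a H ih =>
    obtain ⟨h1, h2⟩ := ih fun a ha => h a (by simp [ha])
    have ha := h a (by simp)
    simp only [List.map_cons, List.prod_cons]
    refine ⟨one_le_mul ha h1, fun a' ha' => ?_⟩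
    rcases List.mem_cons.1 ha' with rfl | ha'
    · exact le_mul_of_one_le_right (by positivity) h1
    · exact (h2 a' ha').trans (le_mul_of_one_le_left (by positivity) ha)

/-- Approximate solutions of the translated instance restrict to approximate solutions of the
original instance. -/
theorem Gadget.exists_target {f : Constraint} {b : Bool} (G : Gadget f b) (F : Set Constraint)
    (x : CSPInst ({forbid b} ∪ F ∪ U)) (W : ℝ≥0) (u : Application x.n → ℝ≥0)
    (hu1 : ∀ a ∈ x.H, 1 ≤ u a) (hu2 : ∀ a ∈ x.H, ∀ z, a.con.val z ≤ u a)
    (hu3 : ∀ a ∈ x.H, ∀ z, a.con.val z ≠ 0 → 1 ≤ a.con.val z * u a)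
    (hW : G.D ≤ W) (hκ : 2 * G.D * (x.H.map u).prod ^ 2 ≤ G.κ * W) (hP : (x.H.map u).prod < W) :
    ∃ w : CSPInst ({f} ∪ F ∪ U),
      w.enc = List.replicate (G.vEnd x.n x.H) 1 ++ 0 :: (G.trans W x.n x.H).flatMap RawApp.enc ∧
      ∀ ε : ℝ, 0 < ε → ε < 1 → ∀ y, (maxProdCSP ({f} ∪ F ∪ U)).IsApproxSol w (2 ^ ε) y →
        (maxProdCSP ({forbid b} ∪ F ∪ U)).IsApproxSol x (2 ^ ε) (y.take x.n) := by
  obtain ⟨hP1, huP⟩ := le_prod_map_of_one_le x.H u hu1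
  obtain ⟨w, hwn, hwe, hwv⟩ := exists_inst ({f} ∪ F ∪ U) (G.vEnd x.n x.H) (G.trans W x.n x.H)
    (G.nodup_trans W x.n le_rfl x.H x.nodup
      fun a ha z => ((hu2 a ha z).trans (huP a ha)).trans_lt hP)
    (fun e he v hv => G.trans_idx_lt W x.n le_rfl x.H e he v hv)
    (fun e he => G.trans_con_mem F W x.n x.H x.mem e he)
  refine ⟨w, hwe, fun ε hε0 hε1 y hy => ?_⟩
  set P := (x.H.map u).prod with hPdef
  set K := G.factor W x.n x.H with hK
  have hK0 : 0 < K := G.factor_pos W hW _ _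
  have hW0 : 0 < W := lt_of_lt_of_le one_pos (G.one_le_D.trans hW)
  have hκW : 0 < G.κ * W := mul_pos G.κ_pos hW0
  have hle := G.le_vEnd x.n x.H
  obtain ⟨hyl, z, ⟨hzl, hzo⟩, -, hz⟩ := hy
  change y.length = w.n at hyl
  change z.length = w.n at hzl
  have htl : (y.take x.n).length = x.n := by rw [List.length_take]; omega
  obtain ⟨z₀, hz₀⟩ := exists_isOptimal x
  refine ⟨htl, z₀, hz₀, fun h0 => ?_, fun h0 => ?_⟩
  -- With optimum zero every solution has measure zero, whatever the oracle answered.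
  · have := hz₀.2 _ htl
    rw [h0] at this
    exact le_antisymm this (zero_le)
  have hmx : ∀ y : List Bool, y.length = x.n →
      (maxProdCSP ({forbid b} ∪ F ∪ U)).measure x y = srcVal x.H (bits y) :=
    fun y h => if_pos h
  have hmw : ∀ y : List Bool, y.length = w.n →
      (maxProdCSP ({f} ∪ F ∪ U)).measure w y = prodVal (G.trans W x.n x.H) (bits y) :=
    fun y h => (if_pos h).trans (hwv y)
  have hle1 := hz₀.2 _ htl
  rw [hmx _ htl, srcVal_take, hmx _ hz₀.1] at hle1
  rw [hmx _ hz₀.1] at h0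
  rw [hmx _ htl, srcVal_take, hmx _ hz₀.1]
  set S := srcVal x.H (bits z₀) with hS
  have hS0 : (0 : ℝ) < S := by exact_mod_cast pos_iff_ne_zero.2 h0
  have hpow : (0 : ℝ) < 2 ^ ε := by positivity
  have hpow1 : (1 : ℝ) ≤ 2 ^ ε := Real.one_le_rpow (by norm_num) hε0.le
  have hpow2 : (2 : ℝ) ^ ε < 2 := by
    conv_rhs => rw [← Real.rpow_one 2]
    exact Real.rpow_lt_rpow_of_exponent_lt (by norm_num) hε1
  obtain ⟨σ', -, hσ'⟩ := G.exists_prodVal_trans_eq W hW x.n le_rfl x.H (bits z₀) h0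
  -- An optimal source assignment extends to the fresh variables with value exactly `K * S`.
  have hz' : K * S ≤ prodVal (G.trans W x.n x.H) (bits z) := by
    have hl : (List.ofFn fun i : Fin w.n => σ' i).length = w.n := by simp
    have := hzo _ hl
    rw [hmw _ hl, hmw _ hzl] at this
    refine le_trans (le_of_eq ?_) this
    rw [← hσ']
    refine prodVal_congr _ _ _ fun e he v hv => ?_
    have := G.trans_idx_lt W x.n le_rfl x.H e he v hv
    rw [← hwn] at this
    simp [bits, List.getD, this]
  have hKS : 0 < K * S := mul_pos hK0 (pos_iff_ne_zero.2 h0)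
  rw [hmw _ hzl, hmw _ hyl] at hz
  have hz := (hz (hKS.trans_le hz').ne').1
  have hTz : (0 : ℝ) < prodVal (G.trans W x.n x.H) (bits z) := by
    exact_mod_cast hKS.trans_le hz'
  rw [div_le_div_iff₀ hpow hTz, one_mul] at hz
  have hη : G.D ≤ G.κ * W * (G.D / (G.κ * W)) := by rw [mul_div_cancel₀ _ hκW.ne']
  have hη1 : G.D / (G.κ * W) ≤ 1 := by
    rw [div_le_one hκW]
    refine le_trans ?_ hκ
    calc G.D = G.D * 1 := (mul_one _).symm
      _ ≤ G.D * (2 * P ^ 2) := mul_le_mul_right (one_le_mul (by norm_num) (one_le_pow₀ hP1)) _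
      _ = _ := by ring
  have hub := G.prodVal_trans_le W _ hW hη x.n x.H (bits y)
  have hz'' : (K * S : ℝ) ≤ prodVal (G.trans W x.n x.H) (bits z) := by exact_mod_cast hz'
  have hK0' : (0 : ℝ) < K := by exact_mod_cast hK0
  have hub' : (prodVal (G.trans W x.n x.H) (bits y) : ℝ) ≤
      K * penVal b (G.D / (G.κ * W)) x.H (bits y) := by exact_mod_cast hub
  have hmain : (S : ℝ) ≤ penVal b (G.D / (G.κ * W)) x.H (bits y) * 2 ^ ε := by
    refine le_of_mul_le_mul_left ?_ hK0'
    calc (K * S : ℝ) ≤ prodVal (G.trans W x.n x.H) (bits y) * 2 ^ ε := hz''.trans hz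
      _ ≤ (K * penVal b (G.D / (G.κ * W)) x.H (bits y)) * 2 ^ ε :=
        mul_le_mul_of_nonneg_right hub' hpow.le
      _ = _ := by ring
  have hratio : (srcVal x.H (bits y) : ℝ) / S ≤ 2 ^ ε := by
    refine le_trans ?_ hpow1
    rw [div_le_one hS0]
    exact_mod_cast hle1
  refine ⟨?_, hratio⟩
  rcases penVal_eq_or_le b _ hη1 x.H (bits y) u hu1 (fun a ha => hu2 a ha _) with ⟨e, -⟩ | hpen
  · rw [e] at hmain
    rw [div_le_div_iff₀ hpow hS0, one_mul]
    exact hmain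
  -- A violation would give `1 ≤ S * P ≤ η * P² * 2^ε` with `η = D / (κ * W)`. But `η * P² ≤ 1/2`
  -- and `2^ε < 2`.
  · exfalso
    have h1 : (1 : ℝ) ≤ S * P := by
      exact_mod_cast one_le_srcVal_mul x.H (bits z₀) u (fun a ha => hu3 a ha _) h0
    have hpen' : (penVal b (G.D / (G.κ * W)) x.H (bits y) : ℝ) ≤ (G.D / (G.κ * W)) * P := by
      exact_mod_cast hpen
    have hκ' : (2 * G.D * P ^ 2 : ℝ) ≤ G.κ * W := by exact_mod_cast hκ
    have hκW' : (0 : ℝ) < G.κ * W := by exact_mod_cast hκW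
    have hP0 : (0 : ℝ) < P := by exact_mod_cast lt_of_lt_of_le one_pos hP1
    have hhalf : (G.D / (G.κ * W) * P ^ 2 : ℝ) ≤ 1 / 2 := by
      rw [div_mul_eq_mul_div, div_le_div_iff₀ hκW' (by norm_num)]
      linarith
    have hn : (0 : ℝ) ≤ G.D / (G.κ * W) * P ^ 2 := by positivity
    have : (1 : ℝ) ≤ (G.D / (G.κ * W) * P ^ 2) * 2 ^ ε := by
      calc (1 : ℝ) ≤ S * P := h1
        _ ≤ (penVal b (G.D / (G.κ * W)) x.H (bits y) * 2 ^ ε) * P :=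
          mul_le_mul_of_nonneg_right hmain hP0.le
        _ ≤ ((G.D / (G.κ * W) * P) * 2 ^ ε) * P := by gcongr
        _ = _ := by ring
    nlinarith

/-! ### The reduction program

The stacks are used as follows: `0` input, `1` query, `2` and `3` the arguments of the application
being replaced (later the answer and the output), `4` buffer, `5` the weight `W`, `6` the next fresh
variable, `7` the number of variables in unary, `8` the accuracy, `9`, `10`, `11` work space. -/

theorem holds_pos_iff {L : List (List ℝ)} {i : ℕ} {a : ℝ} {l : List ℝ}
    (h : L.getD i [] = a :: l) : (Test.pos i).Holds (st L) ↔ 0 < a := by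
  have h : st L i = a :: l := h
  simp only [Test.Holds, h, List.cons.injEq]
  constructor
  · rintro ⟨a', l', ⟨rfl, rfl⟩, h'⟩; exact h'
  · intro h'; exact ⟨a, l, ⟨rfl, rfl⟩, h'⟩

theorem not_holds_nonempty {L : List (List ℝ)} {i : ℕ} (h : L.getD i [] = []) :
    ¬ (Test.nonempty i).Holds (st L) := fun h' => h' h

theorem holds_nonempty {L : List (List ℝ)} {i : ℕ} {a : ℝ} {l : List ℝ}
    (h : L.getD i [] = a :: l) : (Test.nonempty i).Holds (st L) := by
  have h : st L i = a :: l := h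
  simp [Test.Holds, h]

theorem Does.loop_block {c : Test} {l : List Prog} {L L' : List (List ℝ)} {s : Store} {b b' : ℕ}
    (hc : c.Holds (st L)) (hl : l.all (simple L.length) = true)
    (e : l.foldl (fun L p => exL p L) L = L') (h : Does (.loop c (block l)) (st L') s b)
    (hb : 2 * l.length + b + 2 ≤ b') : Does (.loop c (block l)) (st L) s b' :=
  (Does.loop_step hc (does_block l L L' hl e) h).mono (by omega)

/-- The factor of a cell in the bound on the values of an instance. -/
def cellFactor (c : ℝ) : ℝ := 1 / c + c + 1

def cellProd (l : List ℝ) : ℝ := (l.map cellFactor).prod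

variable {l₀ l₁ l₂ l₃ l₄ l₅ l₆ l₇ l₈ l₉ l₁₀ l₁₁ : List ℝ}

/-! ### Elementary loops -/

/-- Stack `5` accumulates the product of the cell factors while the input passes, reversed, to the
buffer; `restoreProg` puts it back. -/
def scanProg : Prog := .loop (.nonempty 0) (block
  [.copy 0 4, .push 9 1, .copy 0 9, .arith .div 9, .copy 0 9, .arith .add 9, .push 9 1,
    .arith .add 9, .copy 9 5, .pop 9, .arith .mul 5, .pop 0])

theorem does_scan (w : ℝ) :
    Does scanProg (st [l₀, l₁, l₂, l₃, l₄, [w], l₆, l₇, l₈, [], l₁₀, l₁₁])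
      (st [[], l₁, l₂, l₃, l₀.reverse ++ l₄, [w * cellProd l₀], l₆, l₇, l₈, [], l₁₀, l₁₁])
      (26 * l₀.length + 1) := by
  unfold scanProg
  induction l₀ generalizing l₄ w with
  | nil => simpa [cellProd] using Does.loop_done (not_holds_nonempty rfl)
  | cons c l ih =>
    have ih := ih (l₄ := c :: l₄) (w * (1 / c + c + 1))
    rw [show (c :: l).reverse ++ l₄ = l.reverse ++ c :: l₄ by simp,
      show w * cellProd (c :: l) = w * (1 / c + c + 1) * cellProd l by
        simp [cellProd, cellFactor, mul_assoc]]
    refine Does.loop_block (holds_nonempty rfl) (by rfl) ?_ ih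
      (by simp only [List.length_cons, List.length_nil]; omega)
    simp only [List.foldl_cons, List.foldl_nil, exL, List.getD_cons_succ, List.getD_cons_zero,
      List.set_cons_succ, List.set_cons_zero, List.tail_cons, ArithOp.eval]

def restoreProg : Prog := .loop (.nonempty 4) (block [.copy 4 0, .pop 4])

theorem does_restore :
    Does restoreProg (st [l₀, l₁, l₂, l₃, l₄, l₅, l₆, l₇, l₈, l₉, l₁₀, l₁₁])
      (st [l₄.reverse ++ l₀, l₁, l₂, l₃, [], l₅, l₆, l₇, l₈, l₉, l₁₀, l₁₁])
      (6 * l₄.length + 1) := by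
  unfold restoreProg
  induction l₄ generalizing l₀ with
  | nil => exact Does.loop_done (not_holds_nonempty rfl)
  | cons c l ih =>
    have ih := ih (l₀ := c :: l₀)
    rw [show (c :: l).reverse ++ l₀ = l.reverse ++ c :: l₀ by simp]
    exact Does.loop_block (holds_nonempty rfl) (by rfl) (by rfl) ih
      (by simp only [List.length_cons, List.length_nil]; omega)

def flushProg : Prog := .loop (.nonempty 4) (block [.copy 4 1, .pop 4])

theorem does_flush :
    Does flushProg (st [l₀, l₁, l₂, l₃, l₄, l₅, l₆, l₇, l₈, l₉, l₁₀, l₁₁])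
      (st [l₀, l₄.reverse ++ l₁, l₂, l₃, [], l₅, l₆, l₇, l₈, l₉, l₁₀, l₁₁])
      (6 * l₄.length + 1) := by
  unfold flushProg
  induction l₄ generalizing l₁ with
  | nil => exact Does.loop_done (not_holds_nonempty rfl)
  | cons c l ih =>
    have ih := ih (l₁ := c :: l₁)
    rw [show (c :: l).reverse ++ l₁ = l.reverse ++ c :: l₁ by simp]
    exact Does.loop_block (holds_nonempty rfl) (by rfl) (by rfl) ih
      (by simp only [List.length_cons, List.length_nil]; omega)

def outputProg : Prog := .loop (.nonempty 4) (block [.copy 4 3, .pop 4])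

theorem does_output :
    Does outputProg (st [l₀, l₁, l₂, l₃, l₄, l₅, l₆, l₇, l₈, l₉, l₁₀, l₁₁])
      (st [l₀, l₁, l₂, l₄.reverse ++ l₃, [], l₅, l₆, l₇, l₈, l₉, l₁₀, l₁₁])
      (6 * l₄.length + 1) := by
  unfold outputProg
  induction l₄ generalizing l₃ with
  | nil => exact Does.loop_done (not_holds_nonempty rfl)
  | cons c l ih =>
    have ih := ih (l₃ := c :: l₃)
    rw [show (c :: l).reverse ++ l₃ = l.reverse ++ c :: l₃ by simp]
    exact Does.loop_block (holds_nonempty rfl) (by rfl) (by rfl) ih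
      (by simp only [List.length_cons, List.length_nil]; omega)

/-- The loop stops at the separator `0`. The number of variables is kept in unary on stack `7`, to
truncate the answer later, and as a number on stack `6`, where fresh variables start. -/
def countProg : Prog := .loop (.pos 0) (block [.push 7 1, .pop 0, .push 6 1, .arith .add 6])

theorem does_count (n : ℕ) (v : ℝ) (r : List ℝ) :
    Does countProg
      (st [List.replicate n 1 ++ 0 :: r, l₁, l₂, l₃, l₄, l₅, [v], l₇, l₈, l₉, l₁₀, l₁₁])
      (st [0 :: r, l₁, l₂, l₃, l₄, l₅, [v + n], List.replicate n 1 ++ l₇, l₈, l₉, l₁₀, l₁₁])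
      (10 * n + 1) := by
  unfold countProg
  induction n generalizing v l₇ with
  | zero => simpa using Does.loop_done (by rw [holds_pos_iff rfl]; exact lt_irrefl _)
  | succ n ih =>
    have ih := ih (l₇ := 1 :: l₇) (v + 1)
    rw [show v + ((n + 1 : ℕ) : ℝ) = v + 1 + n by push_cast; ring,
      show List.replicate (n + 1) (1 : ℝ) ++ l₇ = List.replicate n 1 ++ 1 :: l₇ by
        rw [List.replicate_succ', List.append_assoc]; rfl]
    exact Does.loop_block ((holds_pos_iff rfl).2 one_pos) (by rfl) (by rfl) ih
      (by simp only [List.length_cons, List.length_nil]; omega)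

def powProg : Prog :=
  .loop (.pos 10) (block [.push 11 2, .arith .mul 11, .push 10 1, .arith .sub 10])

theorem does_pow (k : ℕ) (a : ℝ) :
    Does powProg (st [l₀, l₁, l₂, l₃, l₄, l₅, l₆, l₇, l₈, l₉, [(k : ℝ)], [a]])
      (st [l₀, l₁, l₂, l₃, l₄, l₅, l₆, l₇, l₈, l₉, [0], [a * 2 ^ k]]) (10 * k + 1) := by
  unfold powProg
  induction k generalizing a with
  | zero => simpa using Does.loop_done (by rw [holds_pos_iff rfl]; simp)
  | succ k ih =>
    have ih := ih (a * 2)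
    rw [show (k : ℝ) = ((k + 1 : ℕ) : ℝ) - 1 by push_cast; ring] at ih
    rw [pow_succ', ← mul_assoc]
    exact Does.loop_block ((holds_pos_iff rfl).2 (by positivity)) (by rfl) (by rfl) ih
      (by simp only [List.length_cons, List.length_nil]; omega)

def fetchProg : Prog :=
  .loop (.pos 11) (block [.copy 0 4, .pop 0, .push 11 1, .arith .sub 11])

theorem does_fetch (l r : List ℝ) :
    Does fetchProg (st [l ++ r, l₁, l₂, l₃, l₄, l₅, l₆, l₇, l₈, l₉, l₁₀, [(l.length : ℝ)]])
      (st [r, l₁, l₂, l₃, l.reverse ++ l₄, l₅, l₆, l₇, l₈, l₉, l₁₀, [0]])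
      (10 * l.length + 1) := by
  unfold fetchProg
  induction l generalizing l₄ with
  | nil => simpa using Does.loop_done (by rw [holds_pos_iff rfl]; simp)
  | cons c l ih =>
    have ih := ih (l₄ := c :: l₄)
    rw [show (l.length : ℝ) = ((c :: l).length : ℝ) - 1 by push_cast [List.length_cons]; ring] at ih
    rw [show (c :: l).reverse ++ l₄ = l.reverse ++ c :: l₄ by simp]
    exact Does.loop_block ((holds_pos_iff rfl).2 (by simp only [List.length_cons]; positivity))
      (by rfl) (by rfl) ih (by simp only [List.length_cons, List.length_nil]; omega)

def onesProg : Prog := .loop (.pos 6) (block [.push 1 1, .push 6 1, .arith .sub 6])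

theorem does_ones (v : ℕ) :
    Does onesProg (st [l₀, l₁, l₂, l₃, l₄, l₅, [(v : ℝ)], l₇, l₈, l₉, l₁₀, l₁₁])
      (st [l₀, List.replicate v 1 ++ l₁, l₂, l₃, l₄, l₅, [0], l₇, l₈, l₉, l₁₀, l₁₁])
      (8 * v + 1) := by
  unfold onesProg
  induction v generalizing l₁ with
  | zero => simpa using Does.loop_done (by rw [holds_pos_iff rfl]; simp)
  | succ v ih =>
    have ih := ih (l₁ := 1 :: l₁)
    rw [show (v : ℝ) = ((v + 1 : ℕ) : ℝ) - 1 by push_cast; ring] at ih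
    rw [show List.replicate (v + 1) (1 : ℝ) ++ l₁ = List.replicate v 1 ++ 1 :: l₁ by
        rw [List.replicate_succ', List.append_assoc]; rfl]
    exact Does.loop_block ((holds_pos_iff rfl).2 (by positivity)) (by rfl) (by rfl) ih
      (by simp only [List.length_cons, List.length_nil]; omega)

def takeProg : Prog := .loop (.nonempty 7) (block [.copy 2 4, .pop 2, .pop 7])

theorem does_take (n : ℕ) :
    Does takeProg (st [l₀, l₁, l₂, l₃, l₄, l₅, l₆, List.replicate n 1, l₈, l₉, l₁₀, l₁₁])
      (st [l₀, l₁, l₂.drop n, l₃, (l₂.take n).reverse ++ l₄, l₅, l₆, [], l₈, l₉, l₁₀, l₁₁])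
      (8 * n + 1) := by
  unfold takeProg
  induction n generalizing l₂ l₄ with
  | zero => exact Does.loop_done (not_holds_nonempty rfl)
  | succ n ih =>
    cases l₂ with
    -- The answer may be shorter than `n`; copying and popping an empty stack have no effect.
    | nil =>
      have ih := ih (l₂ := []) (l₄ := l₄)
      rw [List.drop_nil, List.take_nil] at ih ⊢
      exact Does.loop_block (holds_nonempty rfl) (by rfl) (by rfl) ih
        (by simp only [List.length_cons, List.length_nil]; omega)
    | cons c l =>
      have ih := ih (l₂ := l) (l₄ := c :: l₄)
      rw [show ((c :: l).take (n + 1)).reverse ++ l₄ = (l.take n).reverse ++ c :: l₄ by simp]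
      exact Does.loop_block (holds_nonempty rfl) (by rfl) (by rfl) ih
        (by simp only [List.length_cons, List.length_nil]; omega)

/-! ### Emitting a gadget -/

/-- Arithmetic expressions for the cells of an emitted gadget. -/
inductive CellExpr where
  | const (c : ℝ)
  | weight
  | nextVar
  | fst
  | snd
  | add (e e' : CellExpr)
  | mul (e e' : CellExpr)

namespace CellExpr

def eval (W v i j : ℝ) : CellExpr → ℝ
  | const c => c
  | weight => W
  | nextVar => v
  | fst => i
  | snd => j
  | add e e' => e.eval W v i j + e'.eval W v i j
  | mul e e' => e.eval W v i j * e'.eval W v i j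

/-- Code that pushes the value of the expression on the query stack. -/
def code : CellExpr → List Prog
  | const c => [.push 1 c]
  | weight => [.copy 5 1]
  | nextVar => [.copy 6 1]
  | fst => [.copy 3 1]
  | snd => [.copy 2 1]
  | add e e' => e.code ++ e'.code ++ [.arith .add 1]
  | mul e e' => e.code ++ e'.code ++ [.arith .mul 1]

theorem code_simple (e : CellExpr) : e.code.all (simple 12) = true := by
  induction e with
  | add e e' h h' | mul e e' h h' => simp only [code, List.all_append, h, h']; rfl
  | _ => rfl

theorem code_foldl (e : CellExpr) (W v i j : ℝ) :
    e.code.foldl (fun L p => exL p L) [l₀, l₁, [j], [i], l₄, [W], [v], l₇, l₈, l₉, l₁₀, l₁₁] =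
      [l₀, e.eval W v i j :: l₁, [j], [i], l₄, [W], [v], l₇, l₈, l₉, l₁₀, l₁₁] := by
  induction e generalizing l₁ with
  | add e e' h h' | mul e e' h h' => simp only [code, List.foldl_append, h, h']; rfl
  | _ => rfl

/-- Code that pushes a list of cells on the query stack, the first cell on top. -/
def codeList : List CellExpr → List Prog
  | [] => []
  | e :: l => codeList l ++ e.code

theorem codeList_simple (l : List CellExpr) : (codeList l).all (simple 12) = true := by
  induction l with
  | nil => rfl
  | cons e l ih => simp only [codeList, List.all_append, ih, code_simple]; rfl

theorem codeList_foldl (l : List CellExpr) (W v i j : ℝ) :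
    (codeList l).foldl (fun L p => exL p L)
        [l₀, l₁, [j], [i], l₄, [W], [v], l₇, l₈, l₉, l₁₀, l₁₁] =
      [l₀, l.map (eval W v i j) ++ l₁, [j], [i], l₄, [W], [v], l₇, l₈, l₉, l₁₀, l₁₁] := by
  induction l with
  | nil => rfl
  | cons e l ih => simp only [codeList, List.foldl_append, ih, code_foldl]; rfl

/-- The variable of an application in a gadget. -/
def ofLocal : ℕ → CellExpr
  | 0 => fst
  | 1 => snd
  | l + 2 => add nextVar (const l)

theorem eval_ofLocal (W : ℝ) (v i j l : ℕ) : (ofLocal l).eval W v i j = (loc i j v l : ℕ) := by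
  rcases l with _ | _ | l <;> simp [ofLocal, eval, loc]

end CellExpr

open CellExpr in
/-- The cells of a unary constraint `scaled b c d` and its variable. -/
def scaledCells (b : Bool) (c : ℝ≥0) (d i : CellExpr) : List CellExpr :=
  [const 1, if b then d else mul (const c) d, if b then mul (const c) d else d, i]

open CellExpr in
def Gadget.cells {f : Constraint} {b : Bool} (G : Gadget f b) : List CellExpr :=
  (G.scopes.flatMap fun s => const f.arity ::
    ((table f.arity f.val).map const ++ List.ofFn fun l => ofLocal (s l))) ++
  ((List.range G.m).flatMap fun l =>
    [const 1, add (const (G.wt l false).1) (mul (const (G.wt l false).2) weight),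
      add (const (G.wt l true).1) (mul (const (G.wt l true).2) weight), add nextVar (const l)]) ++
  (scaledCells b G.nx (add weight nextVar) fst ++
    scaledCells b G.ny (add (add weight nextVar) (const 1)) snd)

theorem enc_unary (c d : ℝ≥0) (u : ℕ) :
    RawApp.enc ⟨unary c d, fun _ => u⟩ = [1, (c : ℝ), (d : ℝ), (u : ℝ)] := by
  simp [RawApp.enc, unary, table]

/-- A copy of the gadget is a fixed list of expressions in `W`, `v`, `i`, `j`, so emitting it takes
a number of steps that does not depend on the instance. -/
theorem Gadget.map_eval_cells {f : Constraint} {b : Bool} (G : Gadget f b) (W : ℝ≥0)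
    (v i j : ℕ) :
    G.cells.map (CellExpr.eval W v i j) = (G.emit W v i j).flatMap RawApp.enc := by
  unfold Gadget.cells Gadget.emit
  simp only [List.map_append, List.flatMap_append]
  congr 1
  · congr 1
    · rw [List.map_flatMap, List.flatMap_map]
      congr 1
      funext s
      simp only [List.map_cons, List.map_append, List.map_map, RawApp.enc, List.map_ofFn]
      congr 2
      · exact List.map_id _
      · congr 1
        funext l
        exact CellExpr.eval_ofLocal W v i j (s l)
    · rw [List.map_flatMap, List.flatMap_map]
      congr 1
      funext l
      rw [enc_unary]
      simp [CellExpr.eval]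
  · simp only [List.flatMap_cons, List.flatMap_nil, scaled, enc_unary, scaledCells]
    cases b <;> simp [CellExpr.eval]

/-! ### Translating one application -/

/-- Moves an application to the buffer and writes `(k - 2)²` on stack `9`, `k` being its arity. -/
def parseProg : Prog :=
  .seq (block [.copy 0 10, .copy 0 9, .push 11 1]) (.seq powProg
    (.seq (block [.pop 10, .copy 9 11, .arith .add 11, .push 11 1, .arith .add 11]) (.seq fetchProg
      (block [.pop 11, .push 9 2, .arith .sub 9, .copy 9 9, .arith .mul 9]))))

theorem Application.length_enc {n : ℕ} (a : Application n) :
    a.enc.length = 2 ^ a.con.arity + a.con.arity + 1 := by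
  simp [Application.enc, table_length]

theorem does_parse {n : ℕ} (a : Application n) (r : List ℝ) :
    Does parseProg (st [a.enc ++ r, l₁, l₂, l₃, [], l₅, l₆, l₇, l₈, [], [], []])
      (st [r, l₁, l₂, l₃, a.enc.reverse, l₅, l₆, l₇, l₈,
        [((a.con.arity : ℝ) - 2) * ((a.con.arity : ℝ) - 2)], [], []])
      (20 * a.enc.length + 40) := by
  have h1 : Does (block [.copy 0 10, .copy 0 9, .push 11 1])
      (st [a.enc ++ r, l₁, l₂, l₃, [], l₅, l₆, l₇, l₈, [], [], []])
      (st [a.enc ++ r, l₁, l₂, l₃, [], l₅, l₆, l₇, l₈, [(a.con.arity : ℝ)], [(a.con.arity : ℝ)],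
        [1]]) _ :=
    does_block _ _ _ rfl (by rfl)
  have h2 := does_pow (l₀ := a.enc ++ r) (l₁ := l₁) (l₂ := l₂) (l₃ := l₃) (l₄ := []) (l₅ := l₅)
    (l₆ := l₆) (l₇ := l₇) (l₈ := l₈) (l₉ := [(a.con.arity : ℝ)]) a.con.arity 1
  -- An application of arity `k` occupies `2 ^ k + k + 1` cells; this number, on stack `11`, tells
  -- `fetchProg` how far to read.
  have h3 : Does (block [.pop 10, .copy 9 11, .arith .add 11, .push 11 1, .arith .add 11])
      (st [a.enc ++ r, l₁, l₂, l₃, [], l₅, l₆, l₇, l₈, [(a.con.arity : ℝ)], [0],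
        [1 * 2 ^ a.con.arity]])
      (st [a.enc ++ r, l₁, l₂, l₃, [], l₅, l₆, l₇, l₈, [(a.con.arity : ℝ)], [],
        [(a.enc.length : ℝ)]]) _ :=
    does_block _ _ _ rfl (by
      rw [show (a.enc.length : ℝ) = 1 * 2 ^ a.con.arity + a.con.arity + 1 by
        rw [a.length_enc]; push_cast; ring]
      rfl)
  have h4 := does_fetch (l₁ := l₁) (l₂ := l₂) (l₃ := l₃) (l₄ := []) (l₅ := l₅) (l₆ := l₆)
    (l₇ := l₇) (l₈ := l₈) (l₉ := [(a.con.arity : ℝ)]) (l₁₀ := []) a.enc r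
  rw [List.append_nil] at h4
  have h5 : Does (block [.pop 11, .push 9 2, .arith .sub 9, .copy 9 9, .arith .mul 9])
      (st [r, l₁, l₂, l₃, a.enc.reverse, l₅, l₆, l₇, l₈, [(a.con.arity : ℝ)], [], [0]])
      (st [r, l₁, l₂, l₃, a.enc.reverse, l₅, l₆, l₇, l₈,
        [((a.con.arity : ℝ) - 2) * ((a.con.arity : ℝ) - 2)], [], []]) _ :=
    does_block _ _ _ rfl (by rfl)
  refine (h1.seq (h2.seq (h3.seq (h4.seq h5)))).mono ?_
  have : a.con.arity ≤ a.enc.length := by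
    rw [a.length_enc]
    exact (Nat.le_add_left _ _).trans (Nat.le_succ _)
  simp only [List.length_cons, List.length_nil]
  omega

/-- Compares the top of the buffer with `c`, adds the square of the difference to stack `9` and
moves the top of the buffer to stack `11`. -/
def compareCmds (c : ℝ) : List Prog :=
  [.copy 4 10, .push 10 c, .arith .sub 10, .copy 10 10, .arith .mul 10, .copy 10 9, .pop 10,
    .arith .add 9, .copy 4 11, .pop 4]

theorem does_compare (c d t : ℝ) (l : List ℝ) :
    Does (block (compareCmds c))
      (st [l₀, l₁, l₂, l₃, t :: l, l₅, l₆, l₇, l₈, [d], [], l₁₁])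
      (st [l₀, l₁, l₂, l₃, l, l₅, l₆, l₇, l₈, [d + (t - c) * (t - c)], [], t :: l₁₁]) 21 :=
  does_block _ _ _ rfl (by
    simp only [compareCmds, List.foldl_cons, List.foldl_nil, exL, List.getD_cons_succ,
      List.getD_cons_zero, List.set_cons_succ, List.set_cons_zero, List.tail_cons, ArithOp.eval])

/-- Tests whether the binary constraint in the buffer has the values `c₀, c₁, c₂, c₃`: stack `9` gets
a positive number if not. -/
def testProg (c₀ c₁ c₂ c₃ : ℝ) : Prog :=
  .seq (block [.pop 9, .copy 4 2, .pop 4, .copy 4 3, .pop 4, .push 9 0])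
    (.seq (block (compareCmds c₃)) (.seq (block (compareCmds c₂))
      (.seq (block (compareCmds c₁)) (block (compareCmds c₀)))))

theorem does_test (c₀ c₁ c₂ c₃ d i j t₀ t₁ t₂ t₃ k : ℝ) :
    Does (testProg c₀ c₁ c₂ c₃)
      (st [l₀, l₁, [], [], [j, i, t₃, t₂, t₁, t₀, k], l₅, l₆, l₇, l₈, [d], [], []])
      (st [l₀, l₁, [j], [i], [k], l₅, l₆, l₇, l₈,
        [0 + (t₃ - c₃) * (t₃ - c₃) + (t₂ - c₂) * (t₂ - c₂) + (t₁ - c₁) * (t₁ - c₁) +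
          (t₀ - c₀) * (t₀ - c₀)], [], [t₀, t₁, t₂, t₃]]) 101 := by
  have h1 : Does (block [.pop 9, .copy 4 2, .pop 4, .copy 4 3, .pop 4, .push 9 0])
      (st [l₀, l₁, [], [], [j, i, t₃, t₂, t₁, t₀, k], l₅, l₆, l₇, l₈, [d], [], []])
      (st [l₀, l₁, [j], [i], [t₃, t₂, t₁, t₀, k], l₅, l₆, l₇, l₈, [0], [], []]) _ :=
    does_block _ _ _ rfl (by rfl)
  exact (h1.seq ((does_compare c₃ 0 t₃ _).seq ((does_compare c₂ _ t₂ _).seq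
    ((does_compare c₁ _ t₁ _).seq (does_compare c₀ _ t₀ _))))).mono
      (by simp only [List.length_cons, List.length_nil]; omega)

/-- Reassembles, in the buffer, a binary application that failed the test, and sends it unchanged to
the query. -/
def keepProg : Prog :=
  .seq (block [.pop 9, .copy 11 4, .pop 11, .copy 11 4, .pop 11]) (.seq
    (block [.copy 11 4, .pop 11, .copy 11 4, .pop 11])
      (.seq (block [.copy 3 4, .pop 3, .copy 2 4, .pop 2]) flushProg))

theorem does_keep (d i j t₀ t₁ t₂ t₃ k : ℝ) :
    Does keepProg
      (st [l₀, l₁, [j], [i], [k], l₅, l₆, l₇, l₈, [d], [], [t₀, t₁, t₂, t₃]])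
      (st [l₀, [k, t₀, t₁, t₂, t₃, i, j] ++ l₁, [], [], [], l₅, l₆, l₇, l₈, [], [], []]) 90 := by
  have h1 : Does (block [.pop 9, .copy 11 4, .pop 11, .copy 11 4, .pop 11])
      (st [l₀, l₁, [j], [i], [k], l₅, l₆, l₇, l₈, [d], [], [t₀, t₁, t₂, t₃]])
      (st [l₀, l₁, [j], [i], [t₁, t₀, k], l₅, l₆, l₇, l₈, [], [], [t₂, t₃]]) _ :=
    does_block _ _ _ rfl (by rfl)
  have h2 : Does (block [.copy 11 4, .pop 11, .copy 11 4, .pop 11])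
      (st [l₀, l₁, [j], [i], [t₁, t₀, k], l₅, l₆, l₇, l₈, [], [], [t₂, t₃]])
      (st [l₀, l₁, [j], [i], [t₃, t₂, t₁, t₀, k], l₅, l₆, l₇, l₈, [], [], []]) _ :=
    does_block _ _ _ rfl (by rfl)
  have h3 : Does (block [.copy 3 4, .pop 3, .copy 2 4, .pop 2])
      (st [l₀, l₁, [j], [i], [t₃, t₂, t₁, t₀, k], l₅, l₆, l₇, l₈, [], [], []])
      (st [l₀, l₁, [], [], [j, i, t₃, t₂, t₁, t₀, k], l₅, l₆, l₇, l₈, [], [], []]) _ :=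
    does_block _ _ _ rfl (by rfl)
  exact (h1.seq (h2.seq (h3.seq does_flush))).mono
    (by simp only [List.length_cons, List.length_nil]; omega)

/-- Replaces the application by a copy of the gadget. -/
def replaceProg {f : Constraint} {b : Bool} (G : Gadget f b) : Prog :=
  .seq (block [.pop 9, .pop 11, .pop 11, .pop 11, .pop 11, .pop 4])
    (.seq (block (CellExpr.codeList G.cells)) (block [.pop 2, .pop 3, .push 6 G.m, .arith .add 6]))

theorem does_replace {f : Constraint} {b : Bool} (G : Gadget f b) (W : ℝ≥0) (v i j : ℕ)
    (d t₀ t₁ t₂ t₃ k : ℝ) :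
    Does (replaceProg G)
      (st [l₀, l₁, [(j : ℝ)], [(i : ℝ)], [k], [(W : ℝ)], [(v : ℝ)], l₇, l₈, [d], [],
        [t₀, t₁, t₂, t₃]])
      (st [l₀, (G.emit W v i j).flatMap RawApp.enc ++ l₁, [], [], [], [(W : ℝ)],
        [((v + G.m : ℕ) : ℝ)], l₇, l₈, [], [], []])
      (2 * (CellExpr.codeList G.cells).length + 25) := by
  have h1 : Does (block [.pop 9, .pop 11, .pop 11, .pop 11, .pop 11, .pop 4])
      (st [l₀, l₁, [(j : ℝ)], [(i : ℝ)], [k], [(W : ℝ)], [(v : ℝ)], l₇, l₈, [d], [],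
        [t₀, t₁, t₂, t₃]])
      (st [l₀, l₁, [(j : ℝ)], [(i : ℝ)], [], [(W : ℝ)], [(v : ℝ)], l₇, l₈, [], [], []]) _ :=
    does_block _ _ _ rfl (by rfl)
  have h2 := does_block (CellExpr.codeList G.cells)
    [l₀, l₁, [(j : ℝ)], [(i : ℝ)], [], [(W : ℝ)], [(v : ℝ)], l₇, l₈, [], [], []] _
    (CellExpr.codeList_simple _) (CellExpr.codeList_foldl G.cells W v i j)
  rw [G.map_eval_cells] at h2
  have h3 : Does (block [.pop 2, .pop 3, .push 6 (G.m : ℝ), .arith .add 6])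
      (st [l₀, (G.emit W v i j).flatMap RawApp.enc ++ l₁, [(j : ℝ)], [(i : ℝ)], [], [(W : ℝ)],
        [(v : ℝ)], l₇, l₈, [], [], []])
      (st [l₀, (G.emit W v i j).flatMap RawApp.enc ++ l₁, [], [], [], [(W : ℝ)],
        [((v + G.m : ℕ) : ℝ)], l₇, l₈, [], [], []]) _ :=
    does_block _ _ _ rfl (by push_cast; rfl)
  exact (h1.seq (h2.seq h3)).mono (by simp only [List.length_cons, List.length_nil]; omega)

/-- Translates one application. -/
def appProg {f : Constraint} {b : Bool} (G : Gadget f b) : Prog :=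
  -- Only positivity can be tested, so inequality is expressed by a positive square: first for the
  -- arity against `2`, then, summed, for the four table entries.
  .seq parseProg (.cond (.pos 9) (.seq (block [.pop 9]) flushProg)
    (.seq (testProg (if b then 1 else 0) 1 1 (if b then 0 else 1))
      (.cond (.pos 9) keepProg (replaceProg G))))

theorem Application.enc_of_arity_eq_two {n : ℕ} (b : Bool) (a : Application n)
    (h : a.con.arity = 2) : ∃ t₀ t₁ t₂ t₃ : ℝ,
      a.enc = [2, t₀, t₁, t₂, t₃, (a.arg 0 : ℝ), (a.arg 1 : ℝ)] ∧
      (a.con = forbid b ↔ t₀ = (if b then 1 else 0) ∧ t₁ = 1 ∧ t₂ = 1 ∧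
        t₃ = (if b then 0 else 1)) := by
  obtain ⟨⟨k, φ⟩, s⟩ := a
  simp only at h
  subst h
  have ht : ∃ t₀ t₁ t₂ t₃ : ℝ, table 2 φ = [t₀, t₁, t₂, t₃] := ⟨_, _, _, _, rfl⟩
  obtain ⟨t₀, t₁, t₂, t₃, ht⟩ := ht
  refine ⟨t₀, t₁, t₂, t₃, ?_, ?_⟩
  · simp [Application.enc, ht, Application.arg, Application.raw, RawApp.idx]
  · have hf : table 2 (fun x : Fin 2 → Bool => if x 0 = b ∧ x 1 = b then (0 : ℝ≥0) else 1) =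
        [(if b then 1 else 0 : ℝ), 1, 1, (if b then 0 else 1 : ℝ)] := by
      cases b <;> simp [table]
    have : (⟨2, φ⟩ : Constraint) = forbid b ↔ table 2 φ =
        table 2 (fun x : Fin 2 → Bool => if x 0 = b ∧ x 1 = b then (0 : ℝ≥0) else 1) := by
      rw [(table_injective 2).eq_iff, forbid]
      simp
    rw [this, ht, hf]
    simp

open Classical in
theorem does_app {f : Constraint} {b : Bool} (G : Gadget f b) (W : ℝ≥0) (v : ℕ) {n : ℕ}
    (a : Application n) (r : List ℝ) :
    Does (appProg G) (st [a.enc ++ r, l₁, [], [], [], [(W : ℝ)], [(v : ℝ)], l₇, l₈, [], [], []])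
      (st [r, (if a.con = forbid b then (G.emit W v (a.arg 0) (a.arg 1)).flatMap RawApp.enc
        else a.enc) ++ l₁, [], [], [], [(W : ℝ)],
        [((if a.con = forbid b then v + G.m else v : ℕ) : ℝ)], l₇, l₈, [], [], []])
      (26 * a.enc.length + (2 * (CellExpr.codeList G.cells).length + 300)) := by
  have hparse := does_parse (l₁ := l₁) (l₂ := []) (l₃ := []) (l₅ := [(W : ℝ)]) (l₆ := [(v : ℝ)])
    (l₇ := l₇) (l₈ := l₈) a r
  by_cases hk : a.con.arity = 2
  · obtain ⟨t₀, t₁, t₂, t₃, henc, hiff⟩ := a.enc_of_arity_eq_two b hk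
    have hrev : a.enc.reverse = [(a.arg 1 : ℝ), (a.arg 0 : ℝ), t₃, t₂, t₁, t₀, 2] := by
      rw [henc]; rfl
    rw [hrev] at hparse
    have htest := does_test (l₀ := r) (l₁ := l₁) (l₅ := [(W : ℝ)]) (l₆ := [(v : ℝ)])
      (l₇ := l₇) (l₈ := l₈) (if b then 1 else 0) 1 1 (if b then 0 else 1)
      (((a.con.arity : ℝ) - 2) * ((a.con.arity : ℝ) - 2)) (a.arg 0) (a.arg 1) t₀ t₁ t₂ t₃ 2
    have hnp : ¬ (Test.pos 9).Holds (st [r, l₁, [], [],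
        [(a.arg 1 : ℝ), (a.arg 0 : ℝ), t₃, t₂, t₁, t₀, 2], [(W : ℝ)], [(v : ℝ)], l₇, l₈,
        [((a.con.arity : ℝ) - 2) * ((a.con.arity : ℝ) - 2)], [], []]) := by
      rw [holds_pos_iff rfl, hk]; norm_num
    by_cases hg : a.con = forbid b
    · simp only [if_pos hg]
      obtain ⟨h0, h1, h2, h3⟩ := hiff.1 hg
      refine (hparse.seq (Does.cond_neg hnp (htest.seq (Does.cond_neg ?_
        (does_replace G W v _ _ _ t₀ t₁ t₂ t₃ 2))))).mono (by omega)
      rw [holds_pos_iff rfl, h0, h1, h2, h3]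
      simp
    · simp only [if_neg hg]
      rw [henc] at hparse ⊢
      refine (hparse.seq (Does.cond_neg hnp (htest.seq (Does.cond_pos ?_
        (does_keep _ _ _ t₀ t₁ t₂ t₃ 2))))).mono (by omega)
      rw [holds_pos_iff rfl]
      by_contra hd
      apply hg
      rw [hiff]
      have key : ∀ p q : ℝ, p - q = 0 → p = q := fun p q h => sub_eq_zero.1 h
      have s0 := mul_self_nonneg (t₀ - if b then 1 else 0)
      have s1 := mul_self_nonneg (t₁ - 1)
      have s2 := mul_self_nonneg (t₂ - 1)
      have s3 := mul_self_nonneg (t₃ - if b then 0 else 1)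
      refine ⟨key _ _ (mul_self_eq_zero.1 ?_), key _ _ (mul_self_eq_zero.1 ?_),
        key _ _ (mul_self_eq_zero.1 ?_), key _ _ (mul_self_eq_zero.1 ?_)⟩ <;> linarith
  · have hg : a.con ≠ forbid b := fun h => hk (by rw [h]; rfl)
    simp only [if_neg hg]
    have hpop : Does (block [.pop 9]) (st [r, l₁, [], [], a.enc.reverse, [(W : ℝ)], [(v : ℝ)],
        l₇, l₈, [((a.con.arity : ℝ) - 2) * ((a.con.arity : ℝ) - 2)], [], []])
        (st [r, l₁, [], [], a.enc.reverse, [(W : ℝ)], [(v : ℝ)], l₇, l₈, [], [], []]) _ :=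
      does_block _ _ _ rfl (by rfl)
    have hflush := does_flush (l₀ := r) (l₁ := l₁) (l₂ := []) (l₃ := []) (l₄ := a.enc.reverse)
      (l₅ := [(W : ℝ)]) (l₆ := [(v : ℝ)]) (l₇ := l₇) (l₈ := l₈) (l₉ := []) (l₁₀ := []) (l₁₁ := [])
    rw [List.reverse_reverse] at hflush
    refine (hparse.seq (Does.cond_pos ?_ (hpop.seq hflush))).mono ?_
    · rw [holds_pos_iff rfl]
      apply mul_self_pos.2
      rw [sub_ne_zero]
      exact_mod_cast hk
    · simp only [List.length_cons, List.length_nil, List.length_reverse]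
      omega

def transProg {f : Constraint} {b : Bool} (G : Gadget f b) : Prog :=
  .loop (.nonempty 0) (appProg G)

theorem does_trans {f : Constraint} {b : Bool} (G : Gadget f b) (W : ℝ≥0) (v : ℕ) {n : ℕ}
    (H : List (Application n)) :
    Does (transProg G)
      (st [H.flatMap Application.enc, l₁, [], [], [], [(W : ℝ)], [(v : ℝ)], l₇, l₈, [], [], []])
      (st [[], (G.trans W v H).flatMap RawApp.enc ++ l₁, [], [], [], [(W : ℝ)],
        [(G.vEnd v H : ℝ)], l₇, l₈, [], [], []])
      ((2 * (CellExpr.codeList G.cells).length + 327) * (H.flatMap Application.enc).length + 1) := by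
  unfold transProg
  induction H generalizing v l₁ with
  | nil => exact Does.loop_done (not_holds_nonempty rfl)
  | cons a H ih =>
    have ha := does_app (l₁ := l₁) (l₇ := l₇) (l₈ := l₈) G W v a (H.flatMap Application.enc)
    have hlen : 1 ≤ a.enc.length := by rw [a.length_enc]; exact Nat.le_add_left _ _
    -- The constant cost `c + 301` of a round is charged to the first cell of the application; `327
    -- = 26 + 301`.
    have hb : ∀ c t : ℕ, 26 * a.enc.length + (c + 300) + ((c + 327) * t + 1) + 1 ≤
        (c + 327) * (a.enc.length + t) + 1 := by
      intro c t
      nlinarith [Nat.mul_le_mul_left (c + 301) hlen]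
    have hne : (Test.nonempty 0).Holds (st [a.enc ++ H.flatMap Application.enc, l₁, [], [], [],
        [(W : ℝ)], [(v : ℝ)], l₇, l₈, [], [], []]) := holds_nonempty rfl
    simp only [List.flatMap_cons, List.length_append, Gadget.trans, Gadget.vEnd]
    split_ifs at ha ⊢ with hg
    · refine (Does.loop_step hne ha (ih (v + G.m))).mono (hb _ _) |> Eq.mp ?_
      rw [List.flatMap_append, List.append_assoc]
    · refine (Does.loop_step hne ha (ih v)).mono (hb _ _) |> Eq.mp ?_
      rw [List.flatMap_append, List.append_assoc]
      simp [Application.enc_raw]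

/-- Each application has at least one cell, so the fresh variables, which are written in unary, are
linear in number. -/
theorem Gadget.vEnd_le {f : Constraint} {b : Bool} (G : Gadget f b) (v : ℕ) {n : ℕ}
    (H : List (Application n)) :
    G.vEnd v H ≤ v + G.m * (H.flatMap Application.enc).length := by
  induction H generalizing v with
  | nil => simp [vEnd]
  | cons a H ih =>
    have hlen : 1 ≤ a.enc.length := by rw [a.length_enc]; exact Nat.le_add_left _ _
    have := Nat.mul_le_mul_left G.m hlen
    simp only [vEnd, List.flatMap_cons, List.length_append, mul_add]
    split
    · exact (ih _).trans (by omega)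
    · exact (ih _).trans (by omega)

/-! ### The reduction given by a gadget -/

/-! ### Bounds on values from the input cells -/

/-- Valid also at `c = 0`, where `1 / c` is `0` for the machine as well. -/
theorem one_le_cellFactor {c : ℝ} (h : 0 ≤ c) : 1 ≤ cellFactor c := by
  have : 0 ≤ 1 / c := by positivity
  unfold cellFactor
  linarith

theorem le_cellFactor {c : ℝ} (h : 0 ≤ c) : c ≤ cellFactor c := by
  have : 0 ≤ 1 / c := by positivity
  unfold cellFactor
  linarith

theorem one_le_mul_cellFactor {c : ℝ} (h : 0 < c) : 1 ≤ c * cellFactor c := by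
  have : c * (1 / c) = 1 := mul_one_div_cancel h.ne'
  unfold cellFactor
  nlinarith

theorem one_le_cellProd (l : List ℝ) (h : ∀ c ∈ l, 0 ≤ c) : 1 ≤ cellProd l := by
  induction l with
  | nil => simp [cellProd]
  | cons c l ih =>
    have h1 := one_le_cellFactor (h c (by simp))
    have h2 := ih fun c hc => h c (by simp [hc])
    simp only [cellProd, List.map_cons, List.prod_cons] at h2 ⊢
    exact one_le_mul_of_one_le_of_one_le h1 h2

theorem cellFactor_le_cellProd (l : List ℝ) (h : ∀ c ∈ l, 0 ≤ c) (c : ℝ) (hc : c ∈ l) :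
    cellFactor c ≤ cellProd l := by
  induction l with
  | nil => simp at hc
  | cons d l ih =>
    have h' : ∀ c ∈ l, 0 ≤ c := fun c hc => h c (by simp [hc])
    have h1 := one_le_cellFactor (h d (by simp))
    have h2 := one_le_cellProd l h'
    have e : cellProd (d :: l) = cellFactor d * cellProd l := by simp [cellProd]
    rw [e]
    rcases List.mem_cons.1 hc with rfl | hc
    · exact le_mul_of_one_le_right (by linarith) h2
    · exact (ih h' hc).trans (le_mul_of_one_le_left (by linarith) h1)

theorem cellProd_append (l l' : List ℝ) : cellProd (l ++ l') = cellProd l * cellProd l' := by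
  simp [cellProd]

theorem mem_table (k : ℕ) (h : (Fin k → Bool) → ℝ≥0) (x : Fin k → Bool) :
    (h x : ℝ) ∈ table k h := by
  induction k with
  | zero => simp [table, Subsingleton.elim x Fin.elim0]
  | succ k ih =>
    rw [← Fin.cons_self_tail x, table, List.mem_append]
    cases x 0
    · exact .inl (ih (fun x => h (Fin.cons false x)) (Fin.tail x))
    · exact .inr (ih (fun x => h (Fin.cons true x)) (Fin.tail x))

theorem table_nonneg (k : ℕ) (h : (Fin k → Bool) → ℝ≥0) (c : ℝ) (hc : c ∈ table k h) : 0 ≤ c := by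
  induction k with
  | zero =>
    simp only [table, List.mem_singleton] at hc
    rw [hc]
    exact NNReal.coe_nonneg _
  | succ k ih =>
    rw [table, List.mem_append] at hc
    rcases hc with hc | hc
    · exact ih _ hc
    · exact ih _ hc

theorem Application.enc_nonneg {n : ℕ} (a : Application n) (c : ℝ) (hc : c ∈ a.enc) : 0 ≤ c := by
  simp only [Application.enc, List.mem_cons, List.mem_append, List.mem_ofFn] at hc
  rcases hc with rfl | hc | ⟨j, rfl⟩
  · positivity
  · exact table_nonneg _ _ _ hc
  · positivity

theorem Application.val_mem_enc {n : ℕ} (a : Application n) (x : Fin a.con.arity → Bool) :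
    (a.con.val x : ℝ) ∈ a.enc := by
  simp only [Application.enc, List.mem_cons, List.mem_append]
  exact .inr (.inl (mem_table _ _ _))

/-- A bound on the values, and on the inverses of the nonzero values, of an application. -/
def Application.bound {n : ℕ} (a : Application n) : ℝ≥0 := (cellProd a.enc).toNNReal

theorem Application.coe_bound {n : ℕ} (a : Application n) : (a.bound : ℝ) = cellProd a.enc :=
  Real.coe_toNNReal _ (zero_le_one.trans (one_le_cellProd _ a.enc_nonneg))

theorem Application.one_le_bound {n : ℕ} (a : Application n) : 1 ≤ a.bound := by
  rw [← NNReal.coe_le_coe, a.coe_bound]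
  exact one_le_cellProd _ a.enc_nonneg

theorem Application.val_le_bound {n : ℕ} (a : Application n) (x : Fin a.con.arity → Bool) :
    a.con.val x ≤ a.bound := by
  rw [← NNReal.coe_le_coe, a.coe_bound]
  exact (le_cellFactor (NNReal.coe_nonneg _)).trans
    (cellFactor_le_cellProd _ a.enc_nonneg _ (a.val_mem_enc x))

theorem Application.one_le_val_mul_bound {n : ℕ} (a : Application n) (x : Fin a.con.arity → Bool)
    (h : a.con.val x ≠ 0) : 1 ≤ a.con.val x * a.bound := by
  rw [← NNReal.coe_le_coe, NNReal.coe_mul, a.coe_bound]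
  have h0 : (0 : ℝ) < a.con.val x := by exact_mod_cast pos_iff_ne_zero.2 h
  exact (one_le_mul_cellFactor h0).trans (mul_le_mul_of_nonneg_left
    (cellFactor_le_cellProd _ a.enc_nonneg _ (a.val_mem_enc x)) h0.le)

/-- The program multiplies the factors of all cells, including the unary prefix. The superfluous
factors are at least `1` and only enlarge the bound. -/
theorem prod_bound_le {F : Set Constraint} (x : CSPInst F) :
    ((x.H.map Application.bound).prod : ℝ) ≤ cellProd x.enc := by
  have h1 : ((x.H.map Application.bound).prod : ℝ) = cellProd (x.H.flatMap Application.enc) := by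
    generalize x.H = H
    induction H with
    | nil => simp [cellProd]
    | cons a H ih =>
      simp only [List.map_cons, List.prod_cons, NNReal.coe_mul, List.flatMap_cons,
        cellProd_append, ih, a.coe_bound]
  have h2 : ∀ c ∈ x.H.flatMap Application.enc, 0 ≤ c := by
    intro c hc
    obtain ⟨a, -, hc⟩ := List.mem_flatMap.1 hc
    exact a.enc_nonneg c hc
  have e : x.enc = (List.replicate x.n 1 ++ [0]) ++ x.H.flatMap Application.enc := by
    simp [CSPInst.enc]
  rw [h1, e, cellProd_append]
  refine le_mul_of_one_le_left (zero_le_one.trans (one_le_cellProd _ h2)) (one_le_cellProd _ ?_)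
  intro c hc
  simp only [List.mem_append, List.mem_replicate, List.mem_singleton] at hc
  rcases hc with ⟨-, rfl⟩ | rfl
  · exact zero_le_one
  · exact le_rfl


/-- The constant factor in the weight `W`. -/
def Gadget.scale {f : Constraint} {b : Bool} (G : Gadget f b) : ℝ≥0 := G.D + 1 + 2 * G.D / G.κ

/-- Writes the oracle query. -/
def Gadget.preProg {f : Constraint} {b : Bool} (G : Gadget f b) : Prog :=
  .seq (block [.copy 0 8, .pop 0, .push 5 1]) (.seq scanProg (.seq restoreProg
    (.seq (block [.copy 5 5, .arith .mul 5, .push 5 G.scale, .arith .mul 5, .push 6 0])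
      (.seq countProg (.seq (block [.pop 0]) (.seq (transProg G)
        (.seq (block [.push 1 0]) (.seq onesProg (block [.copy 8 1])))))))))

/-- Extracts the solution from the answer of the oracle. -/
def postProg : Prog := .seq takeProg outputProg

theorem Gadget.does_pre {f : Constraint} {b : Bool} (G : Gadget f b) {F : Set Constraint} (x : CSPInst F) (W : ℝ≥0)
    (hW : (W : ℝ) = 1 * cellProd x.enc * (1 * cellProd x.enc) * G.scale) (ε : ℝ) :
    Does G.preProg (st [ε :: x.enc, [], [], [], [], [], [], [], [], [], [], []])
      (st [[], ε :: (List.replicate (G.vEnd x.n x.H) 1 ++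
        0 :: (G.trans W x.n x.H).flatMap RawApp.enc), [], [], [], [(W : ℝ)], [0],
        List.replicate x.n 1, [ε], [], [], []])
      ((2 * (CellExpr.codeList G.cells).length + 8 * G.m + 400) * x.enc.length + 200) := by
  have h1 : Does (block [.copy 0 8, .pop 0, .push 5 1])
      (st [ε :: x.enc, [], [], [], [], [], [], [], [], [], [], []])
      (st [x.enc, [], [], [], [], [1], [], [], [ε], [], [], []]) _ :=
    does_block _ _ _ rfl (by rfl)
  have h2 := does_scan (l₀ := x.enc) (l₁ := []) (l₂ := []) (l₃ := []) (l₄ := []) (l₆ := [])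
    (l₇ := []) (l₈ := [ε]) (l₁₀ := []) (l₁₁ := []) 1
  rw [List.append_nil] at h2
  have h3 := does_restore (l₀ := []) (l₁ := []) (l₂ := []) (l₃ := []) (l₄ := x.enc.reverse)
    (l₅ := [1 * cellProd x.enc]) (l₆ := []) (l₇ := []) (l₈ := [ε]) (l₉ := []) (l₁₀ := [])
    (l₁₁ := [])
  rw [List.reverse_reverse, List.append_nil] at h3
  have h4 : Does (block [.copy 5 5, .arith .mul 5, .push 5 (G.scale : ℝ), .arith .mul 5, .push 6 0])
      (st [x.enc, [], [], [], [], [1 * cellProd x.enc], [], [], [ε], [], [], []])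
      (st [x.enc, [], [], [], [], [(W : ℝ)], [0], [], [ε], [], [], []]) _ :=
    does_block _ _ _ rfl (by rw [hW]; rfl)
  have h5 := does_count (l₁ := []) (l₂ := []) (l₃ := []) (l₄ := []) (l₅ := [(W : ℝ)]) (l₇ := [])
    (l₈ := [ε]) (l₉ := []) (l₁₀ := []) (l₁₁ := []) x.n 0 (x.H.flatMap Application.enc)
  rw [List.append_nil, zero_add] at h5
  have h6 : Does (block [.pop 0])
      (st [0 :: x.H.flatMap Application.enc, [], [], [], [], [(W : ℝ)], [(x.n : ℝ)],
        List.replicate x.n 1, [ε], [], [], []])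
      (st [x.H.flatMap Application.enc, [], [], [], [], [(W : ℝ)], [(x.n : ℝ)],
        List.replicate x.n 1, [ε], [], [], []]) _ :=
    does_block _ _ _ rfl (by rfl)
  have h7 := does_trans (l₁ := []) (l₇ := List.replicate x.n 1) (l₈ := [ε]) G W x.n x.H
  rw [List.append_nil] at h7
  have h8 : Does (block [.push 1 0])
      (st [[], (G.trans W x.n x.H).flatMap RawApp.enc, [], [], [], [(W : ℝ)],
        [(G.vEnd x.n x.H : ℝ)], List.replicate x.n 1, [ε], [], [], []])
      (st [[], 0 :: (G.trans W x.n x.H).flatMap RawApp.enc, [], [], [], [(W : ℝ)],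
        [(G.vEnd x.n x.H : ℝ)], List.replicate x.n 1, [ε], [], [], []]) _ :=
    does_block _ _ _ rfl (by rfl)
  have h9 := does_ones (l₀ := []) (l₁ := 0 :: (G.trans W x.n x.H).flatMap RawApp.enc) (l₂ := [])
    (l₃ := []) (l₄ := []) (l₅ := [(W : ℝ)]) (l₇ := List.replicate x.n 1) (l₈ := [ε]) (l₉ := [])
    (l₁₀ := []) (l₁₁ := []) (G.vEnd x.n x.H)
  have h10 : Does (block [.copy 8 1])
      (st [[], List.replicate (G.vEnd x.n x.H) 1 ++ 0 :: (G.trans W x.n x.H).flatMap RawApp.enc,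
        [], [], [], [(W : ℝ)], [0], List.replicate x.n 1, [ε], [], [], []])
      (st [[], ε :: (List.replicate (G.vEnd x.n x.H) 1 ++
        0 :: (G.trans W x.n x.H).flatMap RawApp.enc), [], [], [], [(W : ℝ)], [0],
        List.replicate x.n 1, [ε], [], [], []]) _ :=
    does_block _ _ _ rfl (by rfl)
  refine (h1.seq (h2.seq (h3.seq (h4.seq (h5.seq (h6.seq (h7.seq (h8.seq (h9.seq h10))))))))).mono ?_
  have hv := G.vEnd_le x.n x.H
  have hlen : x.enc.length = x.n + 1 + (x.H.flatMap Application.enc).length := by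
    simp only [CSPInst.enc, List.length_append, List.length_replicate, List.length_cons]
    omega
  have hm : (x.H.flatMap Application.enc).length ≤ x.enc.length := by omega
  have hm1 := Nat.mul_le_mul_left G.m hm
  have hm2 := Nat.mul_le_mul_left (2 * (CellExpr.codeList G.cells).length + 327) hm
  have e : (2 * (CellExpr.codeList G.cells).length + 8 * G.m + 400) * x.enc.length =
      (2 * (CellExpr.codeList G.cells).length + 327) * x.enc.length + 8 * (G.m * x.enc.length) +
        73 * x.enc.length := by ring
  simp only [List.length_cons, List.length_nil, List.length_reverse]
  omega

theorem does_post (n : ℕ) (l₁ l₅ l₆ l₈ ys : List ℝ) :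
    Does postProg (st [[], l₁, ys, [], [], l₅, l₆, List.replicate n 1, l₈, [], [], []])
      (st [[], l₁, ys.drop n, ys.take n, [], l₅, l₆, [], l₈, [], [], []]) (14 * n + 10) := by
  have h1 := does_take (l₀ := []) (l₁ := l₁) (l₂ := ys) (l₃ := []) (l₄ := []) (l₅ := l₅) (l₆ := l₆)
    (l₈ := l₈) (l₉ := []) (l₁₀ := []) (l₁₁ := []) n
  rw [List.append_nil] at h1
  have h2 := does_output (l₀ := []) (l₁ := l₁) (l₂ := ys.drop n) (l₃ := [])
    (l₄ := (ys.take n).reverse) (l₅ := l₅) (l₆ := l₆) (l₇ := [])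
    (l₈ := l₈) (l₉ := []) (l₁₀ := []) (l₁₁ := [])
  rw [List.append_nil, List.reverse_reverse] at h2
  refine (h1.seq h2).mono ?_
  have : (ys.take n).length ≤ n := List.length_take_le n ys
  rw [List.length_reverse]
  omega

theorem initStore_eq (l : List ℝ) :
    Function.update (fun _ => []) 0 l = st [l, [], [], [], [], [], [], [], [], [], [], []] := by
  have : (fun _ => [] : Store) = st (List.replicate 12 []) := by
    funext i
    simp only [st, List.getD_eq_getElem?_getD, List.getElem?_replicate]
    split <;> rfl
  rw [this, update_st _ _ _ (by simp)]
  rfl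

/-- A gadget gives a reduction. -/
theorem Gadget.aptReduces {f : Constraint} {b : Bool} (G : Gadget f b) (F : Set Constraint) :
    APTReduces (maxProdCSPStar ({forbid b} ∪ F)) (maxProdCSPStar ({f} ∪ F)) := by
  -- The oracle accuracy is `ε` itself, so `1/δ` is bounded by the second variable. The time bound
  -- is linear: the preprocessing cost, `14 * n + 10` for the postprocessing, and `3`.
  refine aptReduces_of_single_query _ _ G.preProg postProg (MvPolynomial.X 1)
    (MvPolynomial.C ((2 * (CellExpr.codeList G.cells).length + 8 * G.m + 414 : ℕ) : ℝ) *
      MvPolynomial.X 0 + MvPolynomial.C 213) ?_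
  intro (x : CSPInst ({forbid b} ∪ F ∪ U)) ε hε0 hε1
  set Pr := (cellProd x.enc).toNNReal with hPr
  have hPb := prod_bound_le x
  have hP1 : 1 ≤ (x.H.map Application.bound).prod :=
    (le_prod_map_of_one_le x.H _ fun a _ => a.one_le_bound).1
  have hc0 : 0 ≤ cellProd x.enc := (NNReal.coe_nonneg _).trans hPb
  have hPr' : (Pr : ℝ) = cellProd x.enc := Real.coe_toNNReal _ hc0
  have hPPr : (x.H.map Application.bound).prod ≤ Pr := by
    rw [← NNReal.coe_le_coe, hPr']; exact hPb
  have hPr1 : 1 ≤ Pr := hP1.trans hPPr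
  have hPrsq : Pr ≤ Pr ^ 2 := le_self_pow₀ hPr1 (by norm_num)
  -- In `scale`, the summand `D + 1` secures `D ≤ W` and that `W` exceeds all products of bounds; `2
  -- * D / κ` secures `2 * D * P² ≤ κ * W`.
  set W : ℝ≥0 := Pr ^ 2 * G.scale with hWdef
  have hW : (W : ℝ) = 1 * cellProd x.enc * (1 * cellProd x.enc) * G.scale := by
    rw [hWdef, NNReal.coe_mul, NNReal.coe_pow, hPr']; ring
  have hκ : 2 * G.D = G.κ * (2 * G.D / G.κ) := by rw [mul_div_cancel₀ _ G.κ_pos.ne']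
  obtain ⟨w, hwe, happ⟩ := G.exists_target F x W Application.bound (fun a _ => a.one_le_bound)
    (fun a _ => a.val_le_bound) (fun a _ => a.one_le_val_mul_bound)
    (by
      calc G.D ≤ G.scale := by unfold Gadget.scale; rw [add_assoc]; exact le_self_add
        _ ≤ W := le_mul_of_one_le_left zero_le (one_le_pow₀ hPr1))
    (by
      calc 2 * G.D * (x.H.map Application.bound).prod ^ 2 ≤ 2 * G.D * Pr ^ 2 := by gcongr
        _ = G.κ * (Pr ^ 2 * (2 * G.D / G.κ)) := by rw [mul_left_comm, ← hκ, mul_comm]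
        _ ≤ G.κ * W := by
          rw [hWdef, Gadget.scale]
          gcongr
          exact le_add_self)
    (by
      calc (x.H.map Application.bound).prod ≤ Pr ^ 2 := hPPr.trans hPrsq
        _ < Pr ^ 2 * (G.D + 1) := by
          refine lt_mul_of_one_lt_right (lt_of_lt_of_le one_pos (one_le_pow₀ hPr1)) ?_
          exact lt_of_lt_of_le (lt_add_one 1) (by gcongr; exact G.one_le_D)
        _ ≤ W := by rw [hWdef]; exact mul_le_mul_right le_self_add _)
  have hpre := G.does_pre x W hW ε
  rw [← initStore_eq] at hpre
  refine ⟨w, ε, _, _, 14 * x.n + 10,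
    fun y => st [[], [], (y.map bit).drop x.n, (y.map bit).take x.n, [], [(W : ℝ)], [0], [], [ε],
      [], [], []], hε0, hε1, by simp [polyVal], ?_, hpre, ?_, ?_, ?_⟩
  · change ε :: _ = ε :: w.enc
    rw [hwe]
  · intro y
    rw [update_st _ _ _ (by simp), update_st _ _ _ (by simp)]
    exact does_post x.n [] [(W : ℝ)] [0] [ε] (y.map bit)
  · have hn : x.n ≤ x.enc.length := by
      simp [CSPInst.enc]
    simp only [polyVal, map_add, map_mul, MvPolynomial.eval_C, MvPolynomial.eval_X,
      Matrix.cons_val_zero]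
    have : (2 * (CellExpr.codeList G.cells).length + 8 * G.m + 400) * x.enc.length + 200 +
        (14 * x.n + 10) + 3 ≤
        (2 * (CellExpr.codeList G.cells).length + 8 * G.m + 414) * x.enc.length + 213 := by
      have e : (2 * (CellExpr.codeList G.cells).length + 8 * G.m + 414) * x.enc.length =
          (2 * (CellExpr.codeList G.cells).length + 8 * G.m + 400) * x.enc.length +
            14 * x.enc.length := by ring
      omega
    exact_mod_cast this
  · intro y hy
    have := happ ε hε0 hε1 y hy
    have e : ((y.map bit).take x.n).map (fun r => decide (0 < r)) = y.take x.n := by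
      rw [← List.map_take, List.map_map]
      refine (List.map_congr_left fun c _ => ?_).trans (List.map_id _)
      cases c <;> simp [bit]
    rw [← e] at this
    exact this

/-! ### Closure properties of affine relations and of conjunctions of implications -/

theorem toF2_injective : Function.Injective toF2 := by decide

theorem toF2_xor (x y : Bool) : toF2 (x ^^ y) = toF2 x + toF2 y := by
  cases x <;> cases y <;> decide

/-- A relation closed under `x + y + z` is affine. -/
theorem isAffine_of_closed {k : ℕ} (R : Set (Fin k → Bool))
    (h : ∀ x ∈ R, ∀ y ∈ R, ∀ z ∈ R, (fun l => x l ^^ (y l ^^ z l)) ∈ R) : IsAffine R := by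
  rcases R.eq_empty_or_nonempty with rfl | ⟨r, hr⟩
  -- The empty relation is given by the equation `0 = 1`.
  · refine ⟨1, 0, fun _ => 1, ?_⟩
    ext x
    simp only [Set.mem_empty_iff_false, Matrix.zero_mulVec, Set.mem_ofPred_eq, false_iff]
    intro e
    exact absurd (congrFun e 0) (by decide)
  -- The translate of `R` by `r`. Closure under addition is the hypothesis for `x, y, r`, since `(x
  -- + r) + (y + r) = (x + y + r) + r` in characteristic two.
  let V : Submodule (ZMod 2) (Fin k → ZMod 2) :=
    { carrier := {v | ∃ x ∈ R, v = fun l => toF2 (x l ^^ r l)}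
      add_mem' := by
        rintro _ _ ⟨x, hx, rfl⟩ ⟨y, hy, rfl⟩
        refine ⟨_, h x hx y hy r hr, ?_⟩
        funext l
        rw [Pi.add_apply, ← toF2_xor]
        congr 1
        cases x l <;> cases y l <;> cases r l <;> rfl
      zero_mem' := ⟨r, hr, by funext l; simp [toF2]⟩
      smul_mem' := by
        rintro c _ ⟨x, hx, rfl⟩
        obtain rfl | rfl : c = 0 ∨ c = 1 := by revert c; decide
        · exact ⟨r, hr, by funext l; simp [toF2]⟩
        · exact ⟨x, hx, by rw [one_smul]⟩ }
  let B := Module.finBasis (ZMod 2) ((Fin k → ZMod 2) ⧸ V)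
  let φ := B.equivFun.toLinearMap ∘ₗ V.mkQ
  have hφ : ∀ v, φ v = 0 ↔ v ∈ V := fun v => by simp [φ]
  -- `φ` has kernel `V`, so the coset `r + V` is the solution set of `φ v = φ r`.
  refine ⟨_, LinearMap.toMatrix' φ, φ fun l => toF2 (r l), ?_⟩
  ext x
  rw [Set.mem_ofPred_eq, LinearMap.toMatrix'_mulVec, ← sub_eq_zero, ← map_sub, hφ]
  have e : ((fun l => toF2 (x l)) - fun l => toF2 (r l)) = fun l => toF2 (x l ^^ r l) := by
    funext l
    rw [toF2_xor, Pi.sub_apply, CharTwo.sub_eq_add]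
  rw [e]
  refine ⟨fun hx => ⟨x, hx, rfl⟩, ?_⟩
  rintro ⟨y, hy, e⟩
  have : x = y := by
    funext l
    have := toF2_injective (congrFun e l)
    simpa using this
  rwa [this]

/-- A relation of positive arity closed under conjunction and disjunction is a conjunction of
relations `Δ₀`, `Δ₁` and `Implies`. -/
theorem exists_impAtoms_of_closed {k : ℕ} (hk : 0 < k) (R : Set (Fin k → Bool))
    (hand : ∀ x ∈ R, ∀ y ∈ R, (fun l => x l && y l) ∈ R)
    (hor : ∀ x ∈ R, ∀ y ∈ R, (fun l => x l || y l) ∈ R) :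
    ∃ L : List (ImpAtom k), L ≠ [] ∧ R = {x | ∀ a ∈ L, a.Holds x} := by
  classical
  let atoms : List (ImpAtom k) := (List.finRange k).map .delta0 ++ ((List.finRange k).map .delta1 ++
    (List.finRange k).flatMap fun i => (List.finRange k).map fun j => .implies i j)
  have hatoms : ∀ a, a ∈ atoms := by
    rintro (i | i | ⟨i, j⟩) <;> simp [atoms]
  -- The candidate is the conjunction of all atoms valid on `R`. A trivial implication keeps the
  -- list nonempty.
  refine ⟨atoms.filter fun a => ∀ x ∈ R, a.Holds x, ?_, ?_⟩
  · apply List.ne_nil_of_mem (a := .implies ⟨0, hk⟩ ⟨0, hk⟩)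
    simp [hatoms, ImpAtom.Holds]
  ext x
  simp only [Set.mem_ofPred_eq, List.mem_filter, hatoms, true_and, decide_eq_true_eq]
  refine ⟨fun hx a ha => ha x hx, fun hx => ?_⟩
  have h0 : ∀ i, x i = true → ∃ y ∈ R, y i = true := by
    intro i hi
    by_contra! hc
    have := hx (.delta0 i) fun y hy => by simpa [ImpAtom.Holds] using hc y hy
    simp [ImpAtom.Holds, hi] at this
  have h1 : ∀ j, x j = false → ∃ y ∈ R, y j = false := by
    intro j hj
    by_contra! hc
    have := hx (.delta1 j) fun y hy => by simpa [ImpAtom.Holds] using hc y hy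
    simp [ImpAtom.Holds, hj] at this
  -- An atom that `x` violates is not valid on `R`, so some member of `R` violates it too. A tuple
  -- `x` satisfying the conjunction is rebuilt from such members as a join of meets.
  have h2 : ∀ i j, x i = true → x j = false → ∃ y ∈ R, y i = true ∧ y j = false := by
    intro i j hi hj
    by_contra! hc
    have := hx (.implies i j) fun y hy hyi => by simpa using hc y hy hyi
    simp [ImpAtom.Holds, hi, hj] at this
  have meet : ∀ (Q : (Fin k → Bool) → Prop), (∃ y ∈ R, Q y) →
      (∀ y z, Q y → Q z → Q fun l => y l && z l) →
      (∀ j, x j = false → ∃ y ∈ R, Q y ∧ y j = false) →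
      ∀ S : Finset (Fin k), (∀ j ∈ S, x j = false) →
        ∃ y ∈ R, Q y ∧ ∀ j ∈ S, y j = false := by
    intro Q hne hQ hsep S
    induction S using Finset.induction_on with
    | empty =>
      intro _
      obtain ⟨y, hy, hq⟩ := hne
      exact ⟨y, hy, hq, by simp⟩
    | insert j S _ ih =>
      intro hS
      obtain ⟨y, hy, hq, hyS⟩ := ih fun j hj => hS j (by simp [hj])
      obtain ⟨z, hz, hqz, hzj⟩ := hsep j (hS j (by simp))
      refine ⟨_, hand y hy z hz, hQ y z hq hqz, fun j' hj' => ?_⟩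
      rcases Finset.mem_insert.1 hj' with rfl | hj'
      · simp [hzj]
      · simp [hyS j' hj']
  have below : ∀ i, x i = true → ∃ y ∈ R, y i = true ∧ ∀ j, x j = false → y j = false := by
    intro i hi
    obtain ⟨y, hy, hyi, hyS⟩ := meet (fun y => y i = true) (h0 i hi)
      (fun y z hy hz => by simp [hy, hz]) (fun j hj => h2 i j hi hj)
      (Finset.univ.filter fun j => x j = false) (by simp)
    exact ⟨y, hy, hyi, fun j hj => hyS j (by simp [hj])⟩
  -- The start of the join. If `x` is identically `0`, there is no coordinate to meet below, and the
  -- zero tuple is obtained as a meet of witnesses from `h1`.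
  have bottom : ∃ y ∈ R, ∀ j, x j = false → y j = false := by
    by_cases hi : ∃ i, x i = true
    · obtain ⟨i, hi⟩ := hi
      obtain ⟨y, hy, -, h⟩ := below i hi
      exact ⟨y, hy, h⟩
    · have hz : ∀ j, x j = false := fun j => by
        have := fun h => hi ⟨j, h⟩
        simpa using this
      obtain ⟨y, hy, -⟩ := h1 ⟨0, hk⟩ (hz _)
      obtain ⟨y, hy, -, hyS⟩ := meet (fun _ => True) ⟨y, hy, trivial⟩ (fun _ _ _ _ => trivial)
        (fun j hj => by obtain ⟨y, hy, h⟩ := h1 j hj; exact ⟨y, hy, trivial, h⟩)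
        Finset.univ (fun j _ => hz j)
      exact ⟨y, hy, fun j _ => hyS j (by simp)⟩
  have join : ∀ S : Finset (Fin k), (∀ i ∈ S, x i = true) →
      ∃ y ∈ R, (∀ j, x j = false → y j = false) ∧ ∀ i ∈ S, y i = true := by
    intro S
    induction S using Finset.induction_on with
    | empty =>
      intro _
      obtain ⟨y, hy, h⟩ := bottom
      exact ⟨y, hy, h, by simp⟩
    | insert i S _ ih =>
      intro hS
      obtain ⟨y, hy, hyb, hyS⟩ := ih fun j hj => hS j (by simp [hj])
      obtain ⟨z, hz, hzi, hzb⟩ := below i (hS i (by simp))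
      refine ⟨_, hor y hy z hz, fun j hj => by simp [hyb j hj, hzb j hj], fun i' hi' => ?_⟩
      rcases Finset.mem_insert.1 hi' with rfl | hi'
      · simp [hzi]
      · simp [hyS i' hi']
  obtain ⟨y, hy, hyb, hyS⟩ := join (Finset.univ.filter fun i => x i = true) (by simp)
  have : x = y := by
    funext l
    cases hl : x l
    · exact (hyb l hl).symm
    · exact (hyS l (by simp [hl])).symm
  rwa [this]

/-! ### Binary restrictions of a constraint -/

/-- The tuple that agrees with `x` and `y` where these agree, and otherwise takes the value `a`
where `(x, y)` is `(0, 1)` and the value `c` where it is `(1, 0)`. -/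
def pat {k : ℕ} (x y : Fin k → Bool) (a c : Bool) : Fin k → Bool := fun l =>
  if x l then (if y l then true else c) else (if y l then a else false)

/-- The scope of an application that restricts a constraint along `pat`; the local variables `2` and
`3` are meant to have the values `0` and `1`. -/
def patScope {k : ℕ} (x y : Fin k → Bool) (u v : ℕ) : Fin k → ℕ := fun l =>
  if x l then (if y l then 3 else v) else (if y l then u else 2)

theorem comp_patScope {k : ℕ} (x y : Fin k → Bool) (u v : ℕ) (τ : ℕ → Bool) (h2 : τ 2 = false)
    (h3 : τ 3 = true) : (fun l => τ (patScope x y u v l)) = pat x y (τ u) (τ v) := by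
  funext l
  unfold patScope pat
  cases x l <;> cases y l <;> simp [h2, h3]

/-- A pair of tuples for which both mixed coordinate patterns occur. -/
structure Crossing {k : ℕ} (x y : Fin k → Bool) : Prop where
  left : ∃ l, x l = false ∧ y l = true
  right : ∃ l, x l = true ∧ y l = false

/-- Since both patterns occur, `u` and `v` can be read off the scope; this separates the
applications within a gadget. -/
theorem Crossing.patScope_inj {k : ℕ} {x y : Fin k → Bool} (h : Crossing x y) {u v u' v' : ℕ}
    (e : patScope x y u v = patScope x y u' v') : u = u' ∧ v = v' := by
  obtain ⟨⟨l, hl⟩, l', hl'⟩ := h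
  exact ⟨by simpa [patScope, hl] using congrFun e l, by simpa [patScope, hl'] using congrFun e l'⟩

theorem Crossing.arity_ne {k : ℕ} {x y : Fin k → Bool} (h : Crossing x y) : k ≠ 1 := by
  rintro rfl
  obtain ⟨⟨l, hl⟩, l', hl'⟩ := h
  rw [Subsingleton.elim l' l] at hl'
  simp [hl.1] at hl'

theorem Crossing.exists_two_le {k : ℕ} {x y : Fin k → Bool} (h : Crossing x y) (u v : ℕ)
    (huv : 2 ≤ u ∨ 2 ≤ v) : ∃ l, 2 ≤ patScope x y u v l := by
  obtain ⟨⟨l, hl⟩, l', hl'⟩ := h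
  rcases huv with h | h
  · exact ⟨l, by simpa [patScope, hl] using h⟩
  · exact ⟨l', by simpa [patScope, hl'] using h⟩

theorem patScope_lt {k : ℕ} (x y : Fin k → Bool) {u v n : ℕ} (hu : u < n) (hv : v < n)
    (hn : 4 ≤ n) (l : Fin k) : patScope x y u v l < n := by
  unfold patScope
  split_ifs <;> omega

theorem ident_patScope {k : ℕ} (x y : Fin k → Bool) (u v : ℕ) :
    (fun l => if patScope x y u v l = 1 then 0 else patScope x y u v l) =
      patScope x y (if u = 1 then 0 else u) (if v = 1 then 0 else v) := by
  funext l
  unfold patScope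
  cases x l <;> cases y l <;> simp

/-! ### The gadget for a binary restriction that forbids one constant pair -/

/-- Unary weights: local variables `2` and `3` are pinned to `0` and `1`, the others favour `b`. -/
def chainWt (b : Bool) : ℕ → Bool → ℝ≥0 × ℝ≥0
  | 0, c => if c then (0, 0) else (1, 0)
  | 1, c => if c then (1, 0) else (0, 0)
  | _, c => if c = b then (0, 1) else (1, 0)

theorem gadgetVal_chain (f : Constraint) (b : Bool) (x y : Fin f.arity → Bool) (nx ny W : ℝ≥0)
    (τ : ℕ → Bool) :
    gadgetVal f b 4 [patScope x y 0 4, patScope x y 4 5, patScope x y 5 1] (chainWt b) nx ny W τ =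
      if τ 2 = false ∧ τ 3 = true then
        f.val (pat x y (τ 0) (τ 4)) * f.val (pat x y (τ 4) (τ 5)) * f.val (pat x y (τ 5) (τ 1)) *
          ((if τ 4 = b then W else 1) * (if τ 5 = b then W else 1)) *
          ((if τ 0 = b then nx else 1) * (if τ 1 = b then ny else 1))
      else 0 := by
  have hw : ∀ c, (chainWt b 0 c) = if c then (0, 0) else (1, 0) := fun _ => rfl
  have hw1 : ∀ c, (chainWt b 1 c) = if c then (1, 0) else (0, 0) := fun _ => rfl
  have hw2 : ∀ c, (chainWt b 2 c) = if c = b then (0, 1) else (1, 0) := fun _ => rfl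
  have hw3 : ∀ c, (chainWt b 3 c) = if c = b then (0, 1) else (1, 0) := fun _ => rfl
  have hr : List.range 4 = [0, 1, 2, 3] := rfl
  simp only [gadgetVal, hr, List.map_cons, List.map_nil, List.prod_cons, List.prod_nil, hw, hw1,
    hw2, hw3]
  by_cases h2 : τ 2 = false
  · by_cases h3 : τ 3 = true
    · simp only [comp_patScope x y _ _ τ h2 h3, h2, h3]
      by_cases h4 : τ 4 = b <;> by_cases h5 : τ 5 = b <;> simp [h4, h5, mul_assoc]
    · simp [h3]
  · simp [h2]

/-- The chain `p(x, z) * p(z, z') * p(z', y)` forbids adjacent pairs `(b, b)`. A weight `W` rewards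
each of `z, z'` that equals `b`, and at most one of them can. If `x = y = b`, neither can; otherwise
one can, and the unary factors `α / β` and `α / γ` make the three optimal values equal. Unlike a
direct use of `p(x, y)`, every link of the chain contains a fresh variable. -/
theorem exists_gadget_of_forbid (f : Constraint) (b : Bool) (x y : Fin f.arity → Bool)
    (hxy : Crossing x y) (hb : f.val (pat x y b b) = 0) (hb' : f.val (pat x y (!b) (!b)) ≠ 0)
    (h1 : f.val (pat x y b (!b)) ≠ 0) (h2 : f.val (pat x y (!b) b) ≠ 0) :
    Nonempty (Gadget f b) := by
  obtain ⟨p, hp⟩ : ∃ p : Bool → Bool → ℝ≥0, ∀ a c, f.val (pat x y a c) = p a c :=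
    ⟨_, fun _ _ => rfl⟩
  rw [hp] at hb hb' h1 h2
  set α := p (!b) (!b) with hα
  set β := p b (!b) with hβ
  set γ := p (!b) b with hγ
  have hα0 : 0 < α := pos_iff_ne_zero.2 hb'
  have hβ0 : 0 < β := pos_iff_ne_zero.2 h1
  have hγ0 : 0 < γ := pos_iff_ne_zero.2 h2
  let val : ℝ≥0 → (ℕ → Bool) → ℝ≥0 := gadgetVal f b 4
    [patScope x y 0 4, patScope x y 4 5, patScope x y 5 1] (chainWt b) (α / β) (α / γ)
  have hval : ∀ W τ, val W τ = if τ 2 = false ∧ τ 3 = true then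
      p (τ 0) (τ 4) * p (τ 4) (τ 5) * p (τ 5) (τ 1) *
        ((if τ 4 = b then W else 1) * (if τ 5 = b then W else 1)) *
        ((if τ 0 = b then α / β else 1) * (if τ 1 = b then α / γ else 1)) else 0 := by
    intro W τ
    simp only [val, gadgetVal_chain, hp]
  have hnot : ∀ c : Bool, c = b ∨ c = !b := by cases b <;> decide
  have hcases : ∀ W τ, val W τ = 0 ∨ val W τ = α ^ 3 ∨
      (¬ (τ 0 = b ∧ τ 1 = b) ∧ val W τ = α * β * γ * W) := by
    intro W τ
    rw [hval]
    by_cases hpin : τ 2 = false ∧ τ 3 = true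
    · rw [if_pos hpin]
      have hne : ¬ ((!b) = b) := by cases b <;> decide
      rcases hnot (τ 0) with e0 | e0 <;> rcases hnot (τ 1) with e1 | e1 <;>
        rcases hnot (τ 4) with e4 | e4 <;> rcases hnot (τ 5) with e5 | e5 <;>
        simp only [e0, e1, e4, e5, hb, hne, ← hα, ← hβ, ← hγ, if_true, if_false, zero_mul,
          mul_zero, true_or, and_self, not_true_eq_false, false_and, or_false, and_false,
          not_false_eq_true, true_and]
      all_goals right
      all_goals first
        | (left; field_simp; done)
        | (right; field_simp)
        | field_simp
    · rw [if_neg hpin]; exact .inl rfl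
  -- In `D`, the summand `α ^ 3` bounds the forbidden value, and `α ^ 2 / (β * γ)` ensures `α ^ 3 ≤
  -- κ * W` for `W ≥ D`.
  refine ⟨⟨4, [patScope x y 0 4, patScope x y 4 5, patScope x y 5 1], chainWt b, α / β, α / γ,
    α * β * γ, 1 + α ^ 3 + α ^ 2 / (β * γ), by norm_num, hxy.arity_ne, ?_, ?_, ?_, by positivity,
    by rw [add_assoc]; exact le_self_add, ?_, ?_, ?_⟩⟩
  · intro s hs l
    simp only [List.mem_cons, List.not_mem_nil, or_false] at hs
    rcases hs with rfl | rfl | rfl <;> exact patScope_lt x y (by norm_num) (by norm_num)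
      (by norm_num) l
  · intro s hs
    simp only [List.mem_cons, List.not_mem_nil, or_false] at hs
    rcases hs with rfl | rfl | rfl <;> exact hxy.exists_two_le _ _ (by norm_num)
  · simp only [List.map_cons, List.map_nil, ident_patScope]
    simp only [List.nodup_cons, List.mem_cons, List.not_mem_nil, or_false, not_or,
      not_false_eq_true, List.nodup_nil, and_true]
    refine ⟨⟨?_, ?_⟩, ?_⟩ <;> intro e <;> have := hxy.patScope_inj e <;> simp at this
  · intro W hW τ _
    change val W τ ≤ _
    rcases hcases W τ with e | e | ⟨-, e⟩
    · rw [e]; exact zero_le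
    · rw [e]
      calc α ^ 3 = α * β * γ * (α ^ 2 / (β * γ)) := by field_simp
        _ ≤ _ := mul_le_mul_right (le_add_self.trans hW) _
    · rw [e]
  · intro W hW c d hcd
    let τ : Bool → Bool → ℕ → Bool := fun z z' l => match l with
      | 0 => c | 1 => d | 2 => false | 3 => true | 4 => z | _ => z'
    have hτ : ∀ z z', val W (τ z z') = p c z * p z z' * p z' d *
        ((if z = b then W else 1) * (if z' = b then W else 1)) *
        ((if c = b then α / β else 1) * (if d = b then α / γ else 1)) := fun z z' => by
      rw [hval]; simp [τ]
    have hne : ¬ ((!b) = b) := by cases b <;> decide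
    -- If the first argument is `b`, its neighbour must be `!b` and the reward is taken at the
    -- second inner variable; otherwise it is taken at the first.
    rcases hnot c with e | e
    · have e' : d = !b := (hnot d).resolve_left fun h => hcd ⟨e, h⟩
      refine ⟨τ (!b) b, rfl, rfl, (hτ _ _).trans ?_⟩
      simp only [e, e', hne, ← hβ, ← hγ, if_true, if_false]
      field_simp
    · refine ⟨τ b (!b), rfl, rfl, (hτ _ _).trans ?_⟩
      rcases hnot d with e' | e' <;>
        simp only [e, e', hne, ← hα, ← hβ, ← hγ, if_true, if_false] <;> field_simp
  · intro W hW τ h0 h1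
    change val W τ ≤ _
    rcases hcases W τ with e | e | ⟨h, -⟩
    · rw [e]; exact zero_le
    · rw [e]
      calc α ^ 3 ≤ 1 + α ^ 3 := le_add_self
        _ ≤ _ := le_self_add
    · exact absurd ⟨h0, h1⟩ h

/-! ### The gadget for a constraint with a restriction to disequality -/

/-- The values of the local variables of the gadget, given its arguments `x`, `y` and the value `s` of
the local variable `8`. -/
def litVal (x y s : Bool) : ℕ → Bool
  | 0 => x
  | 1 => y
  | 2 => false
  | 3 => true
  | 4 => !x
  | 5 => x
  | 6 => !y
  | 7 => y
  | 8 => s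
  | _ => !s

/-- The local variable for the complement of the literal `l`. -/
def litNeg (l : ℕ) : ℕ := if l % 2 = 0 then l + 1 else l - 1

theorem litVal_litNeg (x y s : Bool) (l : ℕ) (h2 : 2 ≤ l) (h9 : l ≤ 9) :
    litVal x y s (litNeg l) = !litVal x y s l := by
  interval_cases l <;> simp [litNeg, litVal]

theorem litNeg_bounds (l : ℕ) (h2 : 2 ≤ l) (h9 : l ≤ 9) : 2 ≤ litNeg l ∧ litNeg l ≤ 9 := by
  unfold litNeg
  split <;> omega

/-- The choice among four values by a pair of bits. -/
def sel {α : Type*} (a b : Bool) (z p q r : α) : α :=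
  if a then (if b then r else q) else (if b then p else z)

/-- A ternary relation that witnesses non-affinity yields `NAND` by substitution of literals and
projection. -/
theorem exists_literals (T : Bool → Bool → Bool → Prop) (h000 : T false false false)
    (h011 : T false true true) (h101 : T true false true) (h110 : ¬ T true true false) :
    ∃ p q r : ℕ, (2 ≤ p ∧ p ≤ 9) ∧ (2 ≤ q ∧ q ≤ 9) ∧ (2 ≤ r ∧ r ≤ 9) ∧
      ∀ x y, (∃ s, T (litVal x y s p) (litVal x y s q) (litVal x y s r)) ↔
        ¬ (x = true ∧ y = true) := by
  by_cases h010 : T false true false <;> by_cases h100 : T true false false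
  -- In all cases but the last, setting one coordinate to a constant leaves a binary relation with
  -- exactly three tuples, which suitable negations turn into NAND.
  · refine ⟨5, 7, 2, by norm_num, by norm_num, by norm_num, fun x y => ?_⟩
    cases x <;> cases y <;> simp [litVal, *]
  all_goals by_cases h001 : T false false true <;> by_cases h111 : T true true true
  · refine ⟨5, 2, 6, by norm_num, by norm_num, by norm_num, fun x y => ?_⟩
    cases x <;> cases y <;> simp [litVal, *]
  · refine ⟨5, 7, 3, by norm_num, by norm_num, by norm_num, fun x y => ?_⟩
    cases x <;> cases y <;> simp [litVal, *]
  · refine ⟨4, 6, 3, by norm_num, by norm_num, by norm_num, fun x y => ?_⟩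
    cases x <;> cases y <;> simp [litVal, *]
  · refine ⟨2, 4, 7, by norm_num, by norm_num, by norm_num, fun x y => ?_⟩
    cases x <;> cases y <;> simp [litVal, *]
  · refine ⟨2, 5, 6, by norm_num, by norm_num, by norm_num, fun x y => ?_⟩
    cases x <;> cases y <;> simp [litVal, *]
  · refine ⟨5, 7, 3, by norm_num, by norm_num, by norm_num, fun x y => ?_⟩
    cases x <;> cases y <;> simp [litVal, *]
  · refine ⟨4, 6, 3, by norm_num, by norm_num, by norm_num, fun x y => ?_⟩
    cases x <;> cases y <;> simp [litVal, *]
  · refine ⟨4, 2, 7, by norm_num, by norm_num, by norm_num, fun x y => ?_⟩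
    cases x <;> cases y <;> simp [litVal, *]
  · refine ⟨2, 5, 6, by norm_num, by norm_num, by norm_num, fun x y => ?_⟩
    cases x <;> cases y <;> simp [litVal, *]
  · refine ⟨5, 7, 3, by norm_num, by norm_num, by norm_num, fun x y => ?_⟩
    cases x <;> cases y <;> simp [litVal, *]
  · refine ⟨4, 6, 3, by norm_num, by norm_num, by norm_num, fun x y => ?_⟩
    cases x <;> cases y <;> simp [litVal, *]
  -- Here `T` is exactly `{000, 011, 101}`, and NAND is its projection to the first two coordinates;
  -- only this case uses the variable `s`.
  · refine ⟨5, 7, 8, by norm_num, by norm_num, by norm_num, fun x y => ?_⟩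
    cases x <;> cases y <;> simp [litVal, *]

/-- A non-affine constraint has a scope over literals on which it expresses `NAND`. -/
theorem exists_literal_scope (f : Constraint) (h : ¬ f.HasAffineSupport) :
    ∃ main : Fin f.arity → ℕ, (∀ l, 2 ≤ main l ∧ main l ≤ 9) ∧
      ∀ x y, (∃ s, f.val (fun l => litVal x y s (main l)) ≠ 0) ↔ ¬ (x = true ∧ y = true) := by
  have : ∃ a ∈ f.support, ∃ b ∈ f.support, ∃ c ∈ f.support,
      (fun l => a l ^^ (b l ^^ c l)) ∉ f.support := by
    by_contra! hc
    exact h (isAffine_of_closed _ hc)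
  obtain ⟨a, ha, b, hb, c, hc, habc⟩ := this
  -- Coordinates are grouped by where `b` and `c` differ from `a`. The arguments `000`, `011`, `101`
  -- and `110` then give `a`, `b`, `c` and `a + b + c`.
  obtain ⟨p, q, r, hp, hq, hr, hT⟩ := exists_literals
    (fun P Q R => f.val (fun l => a l ^^ sel (a l ^^ b l) (a l ^^ c l) false P Q R) ≠ 0)
    (by
      convert ha using 3
      funext l
      cases a l <;> cases b l <;> cases c l <;> rfl)
    (by
      convert hb using 3
      funext l
      cases a l <;> cases b l <;> cases c l <;> rfl)
    (by
      convert hc using 3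
      funext l
      cases a l <;> cases b l <;> cases c l <;> rfl)
    (by
      convert habc using 4
      funext l
      cases a l <;> cases b l <;> cases c l <;> rfl)
  have hsel : ∀ l, 2 ≤ sel (a l ^^ b l) (a l ^^ c l) 2 p q r ∧
      sel (a l ^^ b l) (a l ^^ c l) 2 p q r ≤ 9 := by
    intro l
    unfold sel
    split_ifs <;> omega
  refine ⟨fun l => if a l then litNeg (sel (a l ^^ b l) (a l ^^ c l) 2 p q r)
    else sel (a l ^^ b l) (a l ^^ c l) 2 p q r, fun l => ?_, fun x y => ?_⟩
  · dsimp only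
    split
    · exact litNeg_bounds _ (hsel l).1 (hsel l).2
    · exact hsel l
  · rw [← hT x y]
    have e : ∀ s, (fun l => litVal x y s (if a l then litNeg (sel (a l ^^ b l) (a l ^^ c l) 2 p q r)
        else sel (a l ^^ b l) (a l ^^ c l) 2 p q r)) = fun l => a l ^^ sel (a l ^^ b l) (a l ^^ c l)
          false (litVal x y s p) (litVal x y s q) (litVal x y s r) := by
      intro s
      funext l
      have h1 : litVal x y s (sel (a l ^^ b l) (a l ^^ c l) 2 p q r) =
          sel (a l ^^ b l) (a l ^^ c l) false (litVal x y s p) (litVal x y s q)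
            (litVal x y s r) := by
        unfold sel
        split_ifs <;> rfl
      have h2 := litVal_litNeg x y s _ (hsel l).1 (hsel l).2
      rw [← h1]
      split_ifs with hal
      · rw [h2, hal]
        simp
      · simp [hal]
    simp only [e]

/-- Unary weights: local variables `2` and `3` are pinned to `0` and `1`. -/
def pinWt : ℕ → Bool → ℝ≥0 × ℝ≥0
  -- The weight `W` at the pinned value is there only to give the allowed value the required form `κ
  -- * W`.
  | 0, c => if c then (0, 0) else (0, 1)
  | 1, c => if c then (1, 0) else (0, 0)
  | _, _ => (1, 0)

theorem gadgetVal_pin (f : Constraint) (scopes : List (Fin f.arity → ℕ)) (nx ny W : ℝ≥0)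
    (τ : ℕ → Bool) :
    gadgetVal f true 8 scopes pinWt nx ny W τ =
      (if τ 2 = false ∧ τ 3 = true then (scopes.map fun s => f.val fun j => τ (s j)).prod else 0) *
        W * ((if τ 0 = true then nx else 1) * (if τ 1 = true then ny else 1)) := by
  have hr : List.range 8 = [0, 1, 2, 3, 4, 5, 6, 7] := rfl
  have h0 : ∀ c, pinWt 0 c = if c then (0, 0) else (0, 1) := fun _ => rfl
  have h1 : ∀ c, pinWt 1 c = if c then (1, 0) else (0, 0) := fun _ => rfl
  have hl : ∀ l c, pinWt (l + 2) c = (1, 0) := fun _ _ => rfl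
  simp only [gadgetVal, hr, List.map_cons, List.map_nil, List.prod_cons, List.prod_nil, h0, h1,
    hl 0, hl 1, hl 2, hl 3, hl 4, hl 5]
  by_cases h2 : τ 2 = false <;> by_cases h3 : τ 3 = true <;> simp [h2, h3]

/-- Disequalities force the variables `4, …, 7` to be `!x, x, !y, y` and `9` to be the complement of
`8`. The application of `f` along `main` then has a nonzero completion exactly at the arguments
allowed by NAND. Its three maximal weights are equalised by two unary factors and the scale `κ`; the
forbidden value is `0`. -/
theorem exists_gadget_of_neq (f : Constraint) (x y : Fin f.arity → Bool)
    (hxy : Crossing x y) (hneq : ∀ a c, f.val (pat x y a c) ≠ 0 ↔ c = !a)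
    (haff : ¬ f.HasAffineSupport) : Nonempty (Gadget f true) := by
  obtain ⟨main, hmain, hsupp⟩ := exists_literal_scope f haff
  let L : List (Fin f.arity → ℕ) := [patScope x y 0 4, patScope x y 4 5, patScope x y 1 6,
    patScope x y 6 7, patScope x y 8 9]
  -- `main` may coincide with a disequality scope, in which case it must not be listed twice.
  let scopes := L.insert main
  have hmem : ∀ s, s ∈ scopes ↔ s = main ∨ s ∈ L := fun s => List.mem_insert_iff
  have hlt : ∀ s ∈ scopes, ∀ j, s j < 8 + 2 := by
    intro s hs j
    rcases (hmem s).1 hs with rfl | hs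
    · have := hmain j
      omega
    · simp only [L, List.mem_cons, List.not_mem_nil, or_false] at hs
      rcases hs with rfl | rfl | rfl | rfl | rfl <;>
        exact patScope_lt x y (by norm_num) (by norm_num) (by norm_num) j
  let Q : (ℕ → Bool) → ℝ≥0 := fun τ =>
    if τ 2 = false ∧ τ 3 = true then (scopes.map fun s => f.val fun j => τ (s j)).prod else 0
  have hQ : ∀ τ, Q τ ≠ 0 ↔ (τ 2 = false ∧ τ 3 = true) ∧
      ∀ s ∈ scopes, f.val (fun j => τ (s j)) ≠ 0 := by
    intro τ
    by_cases hp : τ 2 = false ∧ τ 3 = true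
    · simp only [Q, hp, if_true, and_self, true_and, ne_eq, List.prod_eq_zero_iff, List.mem_map,
        not_exists, not_and]
    · simp [Q, hp]
  have hLQ : ∀ τ : ℕ → Bool, τ 2 = false → τ 3 = true →
      ((∀ s ∈ L, f.val (fun j => τ (s j)) ≠ 0) ↔ τ 4 = (!τ 0) ∧ τ 5 = (!τ 4) ∧ τ 6 = (!τ 1) ∧
        τ 7 = (!τ 6) ∧ τ 9 = !τ 8) := by
    intro τ h2 h3
    simp only [L, List.forall_mem_cons, List.not_mem_nil, false_imp_iff, implies_true, and_true,
      comp_patScope x y _ _ τ h2 h3, hneq]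
  have hforbid : ∀ τ, Q τ ≠ 0 → ¬ (τ 0 = true ∧ τ 1 = true) := by
    intro τ hτ
    obtain ⟨⟨h2, h3⟩, hs⟩ := (hQ τ).1 hτ
    obtain ⟨h4, h5, h6, h7, h9⟩ := (hLQ τ h2 h3).1 fun s h => hs s ((hmem s).2 (.inr h))
    refine (hsupp (τ 0) (τ 1)).1 ⟨τ 8, ?_⟩
    have := hs main ((hmem _).2 (.inl rfl))
    convert this using 3 with l
    have hl := hmain l
    generalize main l = c at hl
    obtain ⟨hl2, hl9⟩ := hl
    interval_cases c <;> simp [litVal, h2, h3, h4, h5, h6, h7, h9]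
  have hallow : ∀ a c, ¬ (a = true ∧ c = true) → ∃ τ : ℕ → Bool, τ 0 = a ∧ τ 1 = c ∧ Q τ ≠ 0 := by
    intro a c hac
    obtain ⟨s, hs⟩ := (hsupp a c).2 hac
    refine ⟨litVal a c s, rfl, rfl, (hQ _).2 ⟨⟨rfl, rfl⟩, fun t ht => ?_⟩⟩
    rcases (hmem t).1 ht with rfl | ht
    · exact hs
    · exact (hLQ (litVal a c s) rfl rfl).2 (by simp [litVal]) t ht
  have hmax : ∀ a c, ∃ τ₀ : ℕ → Bool, (τ₀ 0 = a ∧ τ₀ 1 = c) ∧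
      ∀ τ : ℕ → Bool, τ 0 = a → τ 1 = c → Q τ ≤ Q τ₀ := by
    intro a c
    -- `Q` depends only on the ten local variables, so the maximum is over a finite set.
    let glue : (Fin 8 → Bool) → ℕ → Bool := fun t l => match l with
      | 0 => a
      | 1 => c
      | l + 2 => if h : l < 8 then t ⟨l, h⟩ else false
    obtain ⟨t, ht⟩ := Finite.exists_max fun t => Q (glue t)
    refine ⟨glue t, ⟨rfl, rfl⟩, fun τ h0 h1 => ?_⟩
    refine le_trans (le_of_eq ?_) (ht fun l => τ (l + 2))
    have hg : ∀ l < 8 + 2, glue (fun l => τ (l + 2)) l = τ l := by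
      intro l hl
      rcases l with _ | _ | l
      · exact h0.symm
      · exact h1.symm
      · simp only [glue]
        rw [dif_pos (by omega)]
    simp only [Q, hg 2 (by norm_num), hg 3 (by norm_num)]
    congr 2
    refine List.map_congr_left fun s hs => ?_
    congr 1
    funext j
    exact (hg _ (hlt s hs j)).symm
  choose τm hτm hle using hmax
  have hpos : ∀ a c, ¬ (a = true ∧ c = true) → 0 < Q (τm a c) := by
    intro a c hac
    obtain ⟨τ, h0, h1, hτ⟩ := hallow a c hac
    exact lt_of_lt_of_le (pos_iff_ne_zero.2 hτ) (hle a c τ h0 h1)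
  have p00 := hpos false false (by decide)
  have p01 := hpos false true (by decide)
  have p10 := hpos true false (by decide)
  set γ := Q (τm false false) with hγ
  set γ₁ := Q (τm false true) with hγ₁
  set γ₂ := Q (τm true false) with hγ₂
  have hnorm : ∀ a c, ¬ (a = true ∧ c = true) → Q (τm a c) *
      ((if a = true then γ / γ₂ else 1) * (if c = true then γ / γ₁ else 1)) = γ := by
    intro a c hac
    cases a <;> cases c
    · simp [hγ]
    · simp [← hγ₁]; field_simp
    · simp [← hγ₂]; field_simp
    · simp at hac
  have hval : ∀ W τ, gadgetVal f true 8 scopes pinWt (γ / γ₂) (γ / γ₁) W τ = Q τ * W *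
      ((if τ 0 = true then γ / γ₂ else 1) * (if τ 1 = true then γ / γ₁ else 1)) :=
    fun W τ => gadgetVal_pin f scopes _ _ W τ
  have hinj := @Crossing.patScope_inj _ x y hxy
  refine ⟨⟨8, scopes, pinWt, γ / γ₂, γ / γ₁, γ, 1, by norm_num, hxy.arity_ne, hlt, ?_, ?_, p00,
    le_rfl, ?_, ?_, ?_⟩⟩
  · intro s hs
    rcases (hmem s).1 hs with rfl | hs
    · obtain ⟨l, -⟩ := hxy.left
      exact ⟨l, (hmain l).1⟩
    · simp only [L, List.mem_cons, List.not_mem_nil, or_false] at hs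
      rcases hs with rfl | rfl | rfl | rfl | rfl <;> exact hxy.exists_two_le _ _ (by norm_num)
  · have hL : (L.map fun s j => if s j = 1 then 0 else s j).Nodup := by
      simp only [L, List.map_cons, List.map_nil, ident_patScope]
      simp only [List.nodup_cons, List.mem_cons, List.not_mem_nil, or_false, not_or,
        not_false_eq_true, List.nodup_nil, and_true]
      refine ⟨⟨?_, ?_, ?_, ?_⟩, ⟨?_, ?_, ?_⟩, ⟨?_, ?_⟩, ?_⟩ <;> intro e <;>
        have := hinj e <;> simp at this
    -- `main` avoids `0` and `1`, so identifying the arguments does not affect it and cannot make it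
    -- equal to a scope that contains one of them.
    by_cases hm : main ∈ L
    · simp only [scopes, List.insert_of_mem hm]
      exact hL
    · simp only [scopes, List.insert_of_not_mem hm, List.map_cons, List.nodup_cons]
      refine ⟨fun hc => hm ?_, hL⟩
      have e0 : (fun j => if main j = 1 then 0 else main j) = main := by
        funext j
        have := hmain j
        rw [if_neg (by omega)]
      rw [e0] at hc
      obtain ⟨l, hl⟩ := hxy.left
      have hml := (hmain l).1
      simp only [L, List.map_cons, List.map_nil, ident_patScope, List.mem_cons, List.not_mem_nil,
        or_false] at hc ⊢
      rcases hc with e | e | e | e | e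
      · rw [e] at hml; simp [patScope, hl] at hml
      · exact .inr (.inl (by simpa using e))
      · rw [e] at hml; simp [patScope, hl] at hml
      · exact .inr (.inr (.inr (.inl (by simpa using e))))
      · exact .inr (.inr (.inr (.inr (by simpa using e))))
  · intro W _ τ hτ
    rw [hval, mul_right_comm]
    refine mul_le_mul_left (le_trans ?_ (hnorm (τ 0) (τ 1) hτ).le) _
    exact mul_le_mul_left (hle _ _ τ rfl rfl) _
  · intro W _ a c hac
    refine ⟨τm a c, (hτm a c).1, (hτm a c).2, ?_⟩
    rw [hval, (hτm a c).1, (hτm a c).2, mul_right_comm, hnorm a c hac]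
  · intro W _ τ h0 h1
    have : Q τ = 0 := by
      by_contra hc
      exact hforbid τ hc ⟨h0, h1⟩
    rw [hval, this]
    simp

/-! ### Existence of a gadget -/

/-- The failure of closure under AND or OR gives the binary restriction. Non-affinity is needed
again only if that restriction is a disequality. -/
theorem exists_gadget (f : Constraint) (haff : ¬ f.HasAffineSupport) (himp : ¬ f.HasImpSupport) :
    ∃ b, Nonempty (Gadget f b) := by
  -- In arity zero all tuples coincide, so every relation is affine.
  have hk : 0 < f.arity := by
    by_contra! hk
    refine haff (isAffine_of_closed _ fun x hx y _ z _ => ?_)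
    convert hx using 1
    funext l
    exact absurd l.2 (by omega)
  have hex : ∃ x ∈ f.support, ∃ y ∈ f.support,
      (fun l => x l && y l) ∉ f.support ∨ (fun l => x l || y l) ∉ f.support := by
    by_contra! hc
    exact himp (exists_impAtoms_of_closed hk _ (fun x hx y hy => (hc x hx y hy).1)
      fun x hx y hy => (hc x hx y hy).2)
  obtain ⟨x, hx, y, hy, hxy⟩ := hex
  have e01 : pat x y false true = x := by
    funext l; unfold pat; cases x l <;> cases y l <;> rfl
  have e10 : pat x y true false = y := by
    funext l; unfold pat; cases x l <;> cases y l <;> rfl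
  have e00 : pat x y false false = fun l => x l && y l := by
    funext l; unfold pat; cases x l <;> cases y l <;> rfl
  have e11 : pat x y true true = fun l => x l || y l := by
    funext l; unfold pat; cases x l <;> cases y l <;> rfl
  have h01 : f.val (pat x y false true) ≠ 0 := by rw [e01]; exact hx
  have h10 : f.val (pat x y true false) ≠ 0 := by rw [e10]; exact hy
  rw [← e00, ← e11] at hxy
  simp only [Constraint.support, Set.mem_ofPred_eq, not_not] at hxy
  -- If a mixed pattern were missing, the restriction would ignore one argument, and its zero at an
  -- equal pair would recur at `(0, 1)` or `(1, 0)`.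
  have hcross : Crossing x y := by
    constructor
    · by_contra! hc
      have : ∀ a a' c, pat x y a c = pat x y a' c := by
        intro a a' c
        funext l
        have := hc l
        unfold pat
        cases h : x l <;> cases h' : y l <;> simp_all
      rcases hxy with h | h
      · exact h10 (by rw [this true false, h])
      · exact h01 (by rw [this false true, h])
    · by_contra! hc
      have : ∀ a c c', pat x y a c = pat x y a c' := by
        intro a c c'
        funext l
        have := hc l
        unfold pat
        cases h : x l <;> cases h' : y l <;> simp_all
      rcases hxy with h | h
      · exact h01 (by rw [this false true false, h])
      · exact h10 (by rw [this true false true, h])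
  by_cases h00 : f.val (pat x y false false) = 0
  · by_cases h11 : f.val (pat x y true true) = 0
    · refine ⟨true, exists_gadget_of_neq f x y hcross ?_ haff⟩
      intro a c
      cases a <;> cases c <;> simp [h00, h01, h10, h11]
    · exact ⟨false, exists_gadget_of_forbid f false x y hcross h00 h11 h01 h10⟩
  · exact ⟨true, exists_gadget_of_forbid f true x y hcross (hxy.resolve_left h00) h00 h10 h01⟩

end MaxProd

end

theorem mainTheorem5 (F : Set MaxProd.Constraint) (f : MaxProd.Constraint)
    (hNZ : f ∉ MaxProd.NZ) (hAffine : ¬ f.HasAffineSupport) (hImp : ¬ f.HasImpSupport) :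
    ∃ g : MaxProd.Constraint, (g = MaxProd.OR ∨ g = MaxProd.NAND) ∧
      MaxProd.APTReduces (MaxProd.maxProdCSPStar ({g} ∪ F))
        (MaxProd.maxProdCSPStar ({f} ∪ F)) := by
  obtain ⟨b, ⟨G⟩⟩ := MaxProd.exists_gadget f hAffine hImp
  refine ⟨MaxProd.forbid b, ?_, G.aptReduces F⟩
  cases b
  · exact .inl MaxProd.forbid_false
  · exact .inr MaxProd.forbid_true
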